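/- Call an associative ring $R$ with identity \emph{abelian} if every idempotent of $R$ is central, \emph{reflexive} if for all $a,b\in R$, $aRb=0$ implies $bRa=0$, \emph{reversible} if for all $a,b\in R$, $ab=0$ implies $ba=0$, and \emph{semicommutative} if for all $a,b\in R$, $ab=0$ implies $aRb=0$. Theorem. Let $p$ be a prime and let $k<8$ be a nonnegative integer. Every finite abelian reflexive ring $R$ of order $p^k$ is reversible and semicommutative. -/

import Mathlib

/-- A ring is reversible if `ab = 0` implies `ba = 0`. -/
def IsReversibleRing (R : Type*) [Ring R] : Prop :=
  ∀ a b : R, a * b = 0 → b * a = 0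

/-- A ring is semicommutative if `ab = 0` implies `aRb = 0`. -/
def IsSemicommutativeRing (R : Type*) [Ring R] : Prop :=
  ∀ a b : R, a * b = 0 → ∀ r : R, a * r * b = 0

/-- A ring is reflexive if `aRb = 0` implies `bRa = 0`. -/
def IsReflexiveRing (R : Type*) [Ring R] : Prop :=
  ∀ a b : R, (∀ r : R, a * r * b = 0) → ∀ r : R, b * r * a = 0

/-- A ring is abelian if each of its idempotents is central. -/
def IsAbelianRing (R : Type*) [Ring R] : Prop :=
  ∀ e : R, IsIdempotentElem e → e ∈ Subring.center R

/-!
A counterexample is shown to have length at least eight over `ℤ`, so that its order is at least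
`p ^ 8`.

Idempotents being central, the ring decomposes into corners, and reversibility needs to be shown
only for the local ones (`isReversibleRing_of_card_dvd`). Let `R` be local with nilpotent radical
`J`, and let `ℓ` be the exponent of the order of an additive subgroup. Suppose `a * b = 0` and
`b * a ≠ 0`; then `a` and `b` lie in `J`.

If the residue field is not a prime field, every inclusion of left ideals increases `ℓ` by at least
two. Hence `J ^ 3 = 0`, the layer `J / J ^ 2` is one-dimensional, and `b * a` vanishes with `a * a`
(`IsNilpotentLocalRadical.mul_eq_zero_of_residue_ne_prime`).

If the residue field is prime, then `R = ℤ + J`, and reflexivity yields `u` in `J` with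
`a * u * b ≠ 0`.

* If `J ^ 4 = 0`, reflexivity gives `s * w = 0 ↔ w * s = 0` for `s` in `J ^ 2` and `w` in `J`.
  Then `a`, `b`, `u` are independent in `J / J ^ 2`, and `J ^ 2 / J ^ 3` is at least
  three-dimensional (`IsNilpotentLocalRadical.mul_eq_zero_of_pow_four_eq_bot`).
* If `J ^ 4 ≠ 0`, the length forces `J ^ 3 / J ^ 4` to be one-dimensional, and then
  `J ^ n = x ^ n * ℤ[x]` for `n ≥ 3` with a single `x` (`IsNilpotentLocalRadical.exists_pow_notMem`).
  The left annihilator `L` of `x ^ 2` in `J` is a two-sided ideal with `J = x * ℤ[x] + L`, and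
  reflexivity gives `x ^ 2 * L = 0`, `x * L * x = 0` and `l * m * x = x * l * m` on `L`. Either
  `J ^ 2 = x ^ 2 * ℤ[x]`, and `L` annihilates `J ^ 2`
  (`IsPowerGenerator.mul_eq_zero_of_sq`), or `J ^ 5 = 0` and `J` is generated modulo `J ^ 2` by `x`
  and one element `y` of `L`. In the latter case all products in question are combinations of
  `x * y * y`, `y * x * y` and `y * y * y` in the socle, and the relations obtained from
  `a * b = 0` make `a * u * b` vanish (`IsPowerGenerator.mul_eq_zero_of_pair`).
-/

/-! ### Powers of the radical -/

/-- `J` is a proper nilpotent two-sided ideal, regarded as an additive subgroup, outside of which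
every element is a unit; thus the ambient ring is local with nilpotent radical `J`. -/
structure IsNilpotentLocalRadical {R : Type*} [Ring R] (J : Submodule ℤ R) : Prop where
  mul_mem_left : ∀ r : R, ∀ j ∈ J, r * j ∈ J
  mul_mem_right : ∀ r : R, ∀ j ∈ J, j * r ∈ J
  isUnit_of_notMem : ∀ r : R, r ∉ J → IsUnit r
  one_notMem : (1 : R) ∉ J
  exists_pow_eq_bot : ∃ n : ℕ, J ^ n = ⊥

namespace IsNilpotentLocalRadical

variable {R : Type*} [Ring R] {J : Submodule ℤ R}

lemma mul_mem_pow {a b : R} {m n : ℕ} (ha : a ∈ J ^ m) (hb : b ∈ J ^ n) :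
    a * b ∈ J ^ (m + n) := by
  rw [pow_add]
  exact Submodule.mul_mem_mul ha hb

lemma mul_mem_pow_succ {a b : R} {m : ℕ} (ha : a ∈ J ^ m) (hb : b ∈ J) :
    a * b ∈ J ^ (m + 1) :=
  mul_mem_pow ha (by rwa [pow_one])

lemma mul_mem_pow_succ' {a b : R} {m : ℕ} (ha : a ∈ J) (hb : b ∈ J ^ m) :
    a * b ∈ J ^ (m + 1) := by
  rw [pow_succ']
  exact Submodule.mul_mem_mul ha hb

lemma mul_mem_sq {a b : R} (ha : a ∈ J) (hb : b ∈ J) : a * b ∈ J ^ 2 := by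
  rw [pow_two]
  exact Submodule.mul_mem_mul ha hb

lemma pow_mul_mem_left (hJ : IsNilpotentLocalRadical J) (m : ℕ) (r : R) {v : R}
    (hv : v ∈ J ^ (m + 1)) : r * v ∈ J ^ (m + 1) := by
  rw [pow_succ'] at hv ⊢
  refine Submodule.mul_induction_on hv (fun x hx y hy => ?_) (fun x y hx hy => ?_)
  · rw [← mul_assoc]
    exact Submodule.mul_mem_mul (hJ.mul_mem_left r x hx) hy
  · rw [mul_add]
    exact Submodule.add_mem _ hx hy

lemma pow_mul_mem_right (hJ : IsNilpotentLocalRadical J) (m : ℕ) (r : R) {v : R}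
    (hv : v ∈ J ^ (m + 1)) : v * r ∈ J ^ (m + 1) := by
  rw [pow_succ] at hv ⊢
  refine Submodule.mul_induction_on hv (fun x hx y hy => ?_) (fun x y hx hy => ?_)
  · rw [mul_assoc]
    exact Submodule.mul_mem_mul hx (hJ.mul_mem_right r y hy)
  · rw [add_mul]
    exact Submodule.add_mem _ hx hy

lemma pow_succ_le (hJ : IsNilpotentLocalRadical J) (m : ℕ) : J ^ (m + 2) ≤ J ^ (m + 1) := by
  rw [pow_succ J (m + 1)]
  exact Submodule.mul_le.2 fun x hx y _ => hJ.pow_mul_mem_right m y hx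

lemma pow_le_pow (hJ : IsNilpotentLocalRadical J) {m n : ℕ} (hm : 1 ≤ m) (h : m ≤ n) :
    J ^ n ≤ J ^ m := by
  induction n, h using Nat.le_induction with
  | base => exact le_rfl
  | succ n hn ih =>
    obtain ⟨k, rfl⟩ : ∃ k, n = k + 1 := ⟨n - 1, by omega⟩
    exact (hJ.pow_succ_le k).trans ih

lemma pow_le_self (hJ : IsNilpotentLocalRadical J) {n : ℕ} (h : 1 ≤ n) : J ^ n ≤ J := by
  simpa using hJ.pow_le_pow le_rfl h

lemma pow_succ_lt (hJ : IsNilpotentLocalRadical J) {m : ℕ} (hm : 1 ≤ m) (h : J ^ m ≠ ⊥) :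
    J ^ (m + 1) < J ^ m := by
  refine lt_of_le_of_ne (hJ.pow_le_pow hm (Nat.le_succ m)) fun heq => h ?_
  obtain ⟨N, hN⟩ := hJ.exists_pow_eq_bot
  have key : ∀ k, J ^ (m + k) = J ^ m := by
    intro k
    induction k with
    | zero => rfl
    | succ k ih => rw [← add_assoc, pow_succ, ih, ← pow_succ, heq]
  rw [← key N, pow_add, hN, Submodule.mul_bot]

lemma sq_lt (hJ : IsNilpotentLocalRadical J) (h : J ≠ ⊥) : J ^ 2 < J := by
  simpa using hJ.pow_succ_lt le_rfl (by simpa using h)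

lemma lt_top (hJ : IsNilpotentLocalRadical J) : J < ⊤ :=
  lt_top_iff_ne_top.2 fun h => hJ.one_notMem (h ▸ Submodule.mem_top)

lemma mem_of_mul_eq_zero_left (hJ : IsNilpotentLocalRadical J) {a b : R} (hab : a * b = 0)
    (hb : b ≠ 0) : a ∈ J := by
  by_contra h
  exact hb ((hJ.isUnit_of_notMem a h).mul_right_eq_zero.1 hab)

lemma mem_of_mul_eq_zero_right (hJ : IsNilpotentLocalRadical J) {a b : R} (hab : a * b = 0)
    (ha : a ≠ 0) : b ∈ J := by
  by_contra h
  exact ha ((hJ.isUnit_of_notMem b h).mul_left_eq_zero.1 hab)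

lemma notMem_of_isUnit (hJ : IsNilpotentLocalRadical J) {a : R} (ha : IsUnit a) : a ∉ J := by
  obtain ⟨u, rfl⟩ := ha
  intro h
  exact hJ.one_notMem (by simpa using hJ.mul_mem_left (↑u⁻¹) _ h)

lemma eq_zero_of_mem_pow {a : R} {n : ℕ} (h : J ^ n = ⊥) (ha : a ∈ J ^ n) : a = 0 := by
  rwa [h, Submodule.mem_bot] at ha

end IsNilpotentLocalRadical

lemma Submodule.exists_of_mem_sup_span_singleton {R : Type*} [Ring R] {M : Submodule ℤ R}
    {v w : R} (h : w ∈ M ⊔ Submodule.span ℤ {v}) : ∃ m ∈ M, ∃ n : ℤ, w = m + n * v := by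
  obtain ⟨m, hm, z, hz, rfl⟩ := Submodule.mem_sup.1 h
  obtain ⟨n, rfl⟩ := Submodule.mem_span_singleton.1 hz
  exact ⟨m, hm, n, by simp⟩

lemma Submodule.lt_sup_span_singleton {R : Type*} [Ring R] {M : Submodule ℤ R}
    {v : R} (h : v ∉ M) : M < M ⊔ Submodule.span ℤ {v} :=
  Submodule.lt_sup_iff_notMem.2 h

lemma Submodule.sup_span_singleton_le {R : Type*} [Ring R] {M N : Submodule ℤ R}
    {v : R} (h : M ≤ N) (hv : v ∈ N) : M ⊔ Submodule.span ℤ {v} ≤ N :=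
  sup_le h ((Submodule.span_singleton_le_iff_mem _ _).2 hv)

/-! ### Large residue rings and radicals with vanishing fourth power -/

namespace IsNilpotentLocalRadical

variable {R : Type*} [Ring R] {J : Submodule ℤ R}

/-- If the residue division ring is larger than a prime field, then a proper inclusion of left
ideals `M < N` contributes at least two to the length over `ℤ`. -/
lemma length_add_two_le (hJ : IsNilpotentLocalRadical J) {ℓ : Submodule ℤ R → ℕ}
    (hℓ : StrictMono ℓ) {g : R} (hg : ∀ n : ℤ, g - n ∉ J) {M N : Submodule ℤ R}
    (hM : ∀ r : R, ∀ m ∈ M, r * m ∈ M) (hN : ∀ r : R, ∀ m ∈ N, r * m ∈ N) (hMN : M < N) :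
    ℓ M + 2 ≤ ℓ N := by
  obtain ⟨n, hn, hnM⟩ := SetLike.exists_of_lt hMN
  have h1 : M < M ⊔ Submodule.span ℤ {n} := Submodule.lt_sup_span_singleton hnM
  have h2 : g * n ∉ M ⊔ Submodule.span ℤ {n} := by
    intro h
    obtain ⟨m, hm, k, hk⟩ := Submodule.exists_of_mem_sup_span_singleton h
    obtain ⟨u, hu⟩ := hJ.isUnit_of_notMem _ (hg k)
    apply hnM
    have h3 : (u : R) * n = m := by rw [hu, sub_mul, hk]; abel
    rw [← Units.inv_mul_cancel_left u n, h3]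
    exact hM _ _ hm
  have h3 := Submodule.lt_sup_span_singleton h2
  have h4 := Submodule.sup_span_singleton_le
    (Submodule.sup_span_singleton_le hMN.le hn) (hN g n hn)
  have := hℓ h1
  have := hℓ h3
  have := hℓ.monotone h4
  omega

/-- The case of a residue division ring that is not a prime field. -/
lemma mul_eq_zero_of_residue_ne_prime (hJ : IsNilpotentLocalRadical J) {ℓ : Submodule ℤ R → ℕ}
    (hℓ : StrictMono ℓ) (hℓ7 : ℓ ⊤ ≤ 7) {g : R} (hg : ∀ n : ℤ, g - n ∉ J) {a b : R}
    (hab : a * b = 0) : b * a = 0 := by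
  by_contra hba
  have ha0 : a ≠ 0 := by rintro rfl; simp at hba
  have hb0 : b ≠ 0 := by rintro rfl; simp at hba
  have ha := hJ.mem_of_mul_eq_zero_left hab hb0
  have hb := hJ.mem_of_mul_eq_zero_right hab ha0
  have hJ2 : J ^ 2 ≠ ⊥ := fun h => hba (eq_zero_of_mem_pow h (mul_mem_sq hb ha))
  have hJ1 : J ≠ ⊥ := fun h => ha0 (by simpa [h] using ha)
  have s0 : ∀ r : R, ∀ m ∈ (⊥ : Submodule ℤ R), r * m ∈ (⊥ : Submodule ℤ R) := by
    rintro r m hm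
    simp [(Submodule.mem_bot ℤ).1 hm]
  have s2 : ∀ r : R, ∀ m ∈ J ^ 2, r * m ∈ J ^ 2 := fun r m hm => hJ.pow_mul_mem_left 1 r hm
  have s3 : ∀ r : R, ∀ m ∈ J ^ 3, r * m ∈ J ^ 3 := fun r m hm => hJ.pow_mul_mem_left 2 r hm
  have st : ∀ r : R, ∀ m ∈ (⊤ : Submodule ℤ R), r * m ∈ (⊤ : Submodule ℤ R) :=
    fun _ _ _ => Submodule.mem_top
  have htop := hJ.length_add_two_le hℓ hg hJ.mul_mem_left st hJ.lt_top
  have hJ3 : J ^ 3 = ⊥ := by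
    by_contra h
    -- The chain `0 < J ^ 3 < J ^ 2 < J < R` has length at least eight.
    have h1 := hJ.length_add_two_le hℓ hg s0 s3 (bot_lt_iff_ne_bot.2 h)
    have h2 := hJ.length_add_two_le hℓ hg s3 s2 (hJ.pow_succ_lt (by norm_num) hJ2)
    have h3 := hJ.length_add_two_le hℓ hg s2 hJ.mul_mem_left (hJ.sq_lt hJ1)
    omega
  have ha2 : a ∉ J ^ 2 := fun h => hba (eq_zero_of_mem_pow hJ3 (mul_mem_pow_succ' hb h))
  have hb2 : b ∉ J ^ 2 := fun h => hba (eq_zero_of_mem_pow hJ3 (mul_mem_pow_succ h ha))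
  let M : Submodule ℤ R := J ^ 2 ⊔ LinearMap.range (LinearMap.mulRight ℤ a)
  have memM : ∀ v ∈ M, ∃ s ∈ J ^ 2, ∃ c : R, v = s + c * a := by
    intro v hv
    obtain ⟨s, hs, z, ⟨c, rfl⟩, rfl⟩ := Submodule.mem_sup.1 hv
    exact ⟨s, hs, c, rfl⟩
  have sM : ∀ r : R, ∀ m ∈ M, r * m ∈ M := by
    intro r m hm
    obtain ⟨s, hs, c, rfl⟩ := memM m hm
    rw [mul_add, ← mul_assoc]
    exact Submodule.add_mem_sup (s2 r s hs) ⟨r * c, rfl⟩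
  have haM : a ∈ M := Submodule.mem_sup_right ⟨1, by simp⟩
  have hMJ : M = J := by
    have hle : M ≤ J := by
      intro v hv
      obtain ⟨s, hs, c, rfl⟩ := memM v hv
      exact J.add_mem (hJ.pow_le_self (by norm_num) hs) (hJ.mul_mem_left c a ha)
    by_contra hne
    have h1 := hJ.length_add_two_le hℓ hg s0 s2 (bot_lt_iff_ne_bot.2 hJ2)
    have h2 : J ^ 2 < M := lt_of_le_of_ne le_sup_left fun h => ha2 (h ▸ haM)
    have h2 := hJ.length_add_two_le hℓ hg s2 sM h2
    have h3 := hJ.length_add_two_le hℓ hg sM hJ.mul_mem_left (lt_of_le_of_ne hle hne)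
    omega
  -- `J` is generated by `a` modulo `J ^ 2` as a left ideal; this moves the coefficients in
  -- `a * b` to the left and shows `a * a = 0`.
  obtain ⟨s, hs, c, rfl⟩ := memM b (hMJ ▸ hb)
  obtain ⟨s', hs', c', hc'⟩ := memM (a * c) (hMJ ▸ hJ.mul_mem_right c a ha)
  have hc : IsUnit c := hJ.isUnit_of_notMem c fun h =>
    hb2 (Submodule.add_mem _ hs (mul_mem_sq h ha))
  have hc'u : IsUnit c' := hJ.isUnit_of_notMem c' fun h => by
    have h1 : a * c ∈ J ^ 2 := hc' ▸ Submodule.add_mem _ hs' (mul_mem_sq h ha)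
    obtain ⟨u, rfl⟩ := hc
    apply ha2
    rw [← Units.mul_inv_cancel_right a u]
    exact hJ.pow_mul_mem_right 1 _ h1
  have has : a * s = 0 := eq_zero_of_mem_pow hJ3 (mul_mem_pow_succ' ha hs)
  have hsa : s * a = 0 := eq_zero_of_mem_pow hJ3 (mul_mem_pow_succ hs ha)
  have hs'a : s' * a = 0 := eq_zero_of_mem_pow hJ3 (mul_mem_pow_succ hs' ha)
  rw [mul_add, has, zero_add, ← mul_assoc, hc', add_mul, hs'a, zero_add, mul_assoc,
    hc'u.mul_right_eq_zero] at hab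
  apply hba
  rw [add_mul, hsa, zero_add, mul_assoc, hab, mul_zero]

/-- If the residue field is a prime field and `a * b = 0 ≠ b * a`, then reflexivity provides an
element `u` of the radical with `a * u * b ≠ 0`. -/
lemma exists_mul_mul_ne_zero (href : IsReflexiveRing R)
    (hZ : ∀ r : R, ∃ n : ℤ, r - n ∈ J) {a b : R} (hab : a * b = 0) (hba : b * a ≠ 0) :
    ∃ u ∈ J, a * u * b ≠ 0 := by
  by_contra! h
  suffices h0 : ∀ r : R, a * r * b = 0 from hba (by simpa using href a b h0 1)
  intro r
  obtain ⟨n, hn⟩ := hZ r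
  have h1 := h _ hn
  have h2 : a * r * b = a * (r - n) * b + n * (a * b) := by
    rw [mul_sub, sub_mul, ← (Int.cast_commute n a).eq, mul_assoc (n : R)]
    abel
  rw [h2, h1, hab]
  simp

/-- The case `J ^ 4 = 0` with prime residue field. -/
lemma mul_eq_zero_of_pow_four_eq_bot (hJ : IsNilpotentLocalRadical J) {ℓ : Submodule ℤ R → ℕ}
    (hℓ : StrictMono ℓ) (hℓ7 : ℓ ⊤ ≤ 7) (href : IsReflexiveRing R)
    (hZ : ∀ r : R, ∃ n : ℤ, r - n ∈ J) (h4 : J ^ 4 = ⊥) {a b : R}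
    (hab : a * b = 0) : b * a = 0 := by
  by_contra hba
  have ha0 : a ≠ 0 := by rintro rfl; simp at hba
  have hb0 : b ≠ 0 := by rintro rfl; simp at hba
  have ha := hJ.mem_of_mul_eq_zero_left hab hb0
  have hb := hJ.mem_of_mul_eq_zero_right hab ha0
  obtain ⟨u, hu, haub⟩ := exists_mul_mul_ne_zero href hZ hab hba
  have z31 {s t : R} (hs : s ∈ J ^ 3) (ht : t ∈ J) : s * t = 0 :=
    eq_zero_of_mem_pow h4 (mul_mem_pow_succ hs ht)
  have z13 {s t : R} (hs : s ∈ J) (ht : t ∈ J ^ 3) : s * t = 0 :=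
    eq_zero_of_mem_pow h4 (mul_mem_pow_succ' hs ht)
  have z22 {s t : R} (hs : s ∈ J ^ 2) (ht : t ∈ J ^ 2) : s * t = 0 :=
    eq_zero_of_mem_pow h4 (mul_mem_pow hs ht)
  -- Between `J ^ 2` and `J`, reflexivity is already reversibility.
  have sw {s w : R} (hs : s ∈ J ^ 2) (hw : w ∈ J) (h : s * w = 0) : w * s = 0 := by
    by_contra h'
    obtain ⟨v, hv, hne⟩ := exists_mul_mul_ne_zero href hZ h h'
    exact hne (z31 (mul_mem_pow_succ hs hv) hw)
  have ws {s w : R} (hs : s ∈ J ^ 2) (hw : w ∈ J) (h : w * s = 0) : s * w = 0 := by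
    by_contra h'
    obtain ⟨v, hv, hne⟩ := exists_mul_mul_ne_zero href hZ h h'
    exact hne (by rw [mul_assoc]; exact z13 hw (mul_mem_pow_succ' hv hs))
  have hau := mul_mem_sq ha hu
  have hub := mul_mem_sq hu hb
  have hbu := mul_mem_sq hb hu
  have hba2 := mul_mem_sq hb ha
  have ha2 : a ∉ J ^ 2 := fun h => haub (z31 (mul_mem_pow_succ h hu) hb)
  have hbau : b * (a * u) ≠ 0 := fun h => haub (ws hau hb h)
  have huba : u * b * a ≠ 0 := fun h => haub (by rw [mul_assoc]; exact sw hub ha h)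
  have hba_b : b * a * b = 0 := by rw [mul_assoc, hab, mul_zero]
  have hb_ba : b * (b * a) = 0 := sw hba2 hb hba_b
  have ha_ba : a * (b * a) = 0 := by rw [← mul_assoc, hab, zero_mul]
  have hba_a : b * a * a = 0 := ws hba2 ha ha_ba
  have hba3 : b * a ∉ J ^ 3 := fun h => hbau (by rw [← mul_assoc]; exact z31 h hu)
  -- `a` and `b` are independent modulo `J ^ 2`
  have hb2 : b ∉ J ^ 2 ⊔ Submodule.span ℤ {a} := by
    intro h
    obtain ⟨s, hs, c, rfl⟩ := Submodule.exists_of_mem_sup_span_singleton h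
    have hcJ : (c : R) ∉ J := fun hc =>
      haub (z22 hau (Submodule.add_mem _ hs (mul_mem_sq hc ha)))
    have hcu := hJ.isUnit_of_notMem _ hcJ
    have haa : (c : R) * (a * (a * u)) = 0 := by
      have h1 : a * (c * a) = -(a * s) := by
        rw [mul_add] at hab
        exact eq_neg_of_add_eq_zero_right hab
      have h2 : (c : R) * (a * (a * u)) = a * (c * a) * u := by
        rw [← mul_assoc a (c : R), ← (Int.cast_commute c a).eq]
        noncomm_ring
      rw [h2, h1, neg_mul, z31 (mul_mem_pow_succ' ha hs) hu, neg_zero]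
    rw [hcu.mul_right_eq_zero] at haa
    have h3 : a * u * a = 0 := ws hau ha haa
    apply haub
    rw [mul_add, z22 hau hs, zero_add, ← mul_assoc, ← (Int.cast_commute c (a * u)).eq, mul_assoc,
      h3, mul_zero]
  -- `u` is independent of `a` and `b` modulo `J ^ 2`
  have hu2 : u ∉ J ^ 2 ⊔ Submodule.span ℤ {a} ⊔ Submodule.span ℤ {b} := by
    intro h
    obtain ⟨t, ht, d, rfl⟩ := Submodule.exists_of_mem_sup_span_singleton h
    obtain ⟨s, hs, c, rfl⟩ := Submodule.exists_of_mem_sup_span_singleton ht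
    apply haub
    have h1 : a * a * b = 0 := by rw [mul_assoc, hab, mul_zero]
    have h2 : a * (s + c * a + d * b) * b = a * s * b + c * (a * a * b) + d * (a * b) * b := by
      have h3 := (Int.cast_commute c a).eq
      have h4 := (Int.cast_commute d a).eq
      rw [mul_add, mul_add, ← mul_assoc a (c : R), ← h3, ← mul_assoc a (d : R), ← h4]
      noncomm_ring
    rw [h2, h1, hab, z31 (mul_mem_pow_succ' ha hs) hb]
    simp
  have hJ3 : J ^ 3 ≠ ⊥ := fun h =>
    haub (eq_zero_of_mem_pow h (mul_mem_pow_succ hau hb))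
  -- Hence `J / J ^ 2` has length at least three, and any two independent elements
  -- generate `J ^ 2 / J ^ 3`.
  have gen {v w : R} (hv : v ∈ J ^ 2) (hw : w ∈ J ^ 2) (hv3 : v ∉ J ^ 3)
      (hw3 : w ∉ J ^ 3 ⊔ Submodule.span ℤ {v}) :
      J ^ 2 = J ^ 3 ⊔ Submodule.span ℤ {v} ⊔ Submodule.span ℤ {w} := by
    -- Otherwise `R / J`, `J / J ^ 2`, `J ^ 2 / J ^ 3` and `J ^ 3` have length at least
    -- `1`, `3`, `3` and `1`.
    by_contra hne
    have h21 : J ^ 2 ≤ J := hJ.pow_le_self (by norm_num)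
    have h32 : J ^ 3 ≤ J ^ 2 := hJ.pow_succ_le 1
    have l1 := hℓ (bot_lt_iff_ne_bot.2 hJ3)
    have l2 := hℓ (Submodule.lt_sup_span_singleton hv3)
    have l3 := hℓ (Submodule.lt_sup_span_singleton hw3)
    have l4 := hℓ (lt_of_le_of_ne (Submodule.sup_span_singleton_le
      (Submodule.sup_span_singleton_le h32 hv) hw) (Ne.symm hne))
    have l5 := hℓ (Submodule.lt_sup_span_singleton ha2)
    have l6 := hℓ (Submodule.lt_sup_span_singleton hb2)
    have l7 := hℓ (lt_of_le_of_ne (Submodule.sup_span_singleton_le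
      (Submodule.sup_span_singleton_le h21 ha) hb) (fun h => hu2 (by rw [h]; exact hu)))
    have l8 := hℓ hJ.lt_top
    omega
  have hau3 : a * u ∉ J ^ 3 ⊔ Submodule.span ℤ {b * a} := by
    intro h
    obtain ⟨s, hs, c, hc⟩ := Submodule.exists_of_mem_sup_span_singleton h
    apply hbau
    rw [hc, mul_add, z13 hb hs, zero_add, ← mul_assoc, ← (Int.cast_commute c b).eq, mul_assoc,
      hb_ba, mul_zero]
  have hub3 : u * b ∉ J ^ 3 ⊔ Submodule.span ℤ {b * a} := by
    intro h
    obtain ⟨s, hs, c, hc⟩ := Submodule.exists_of_mem_sup_span_singleton h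
    apply huba
    rw [hc, add_mul, z31 hs ha, zero_add, mul_assoc, hba_a, mul_zero]
  have gen1 := gen hba2 hau hba3 hau3
  have gen2 := gen hba2 hub hba3 hub3
  have dec {v w : R} (hv : v ∈ J ^ 2)
      (h : J ^ 2 = J ^ 3 ⊔ Submodule.span ℤ {b * a} ⊔ Submodule.span ℤ {w}) :
      ∃ s ∈ J ^ 3, ∃ c d : ℤ, v = s + c * (b * a) + d * w := by
    rw [h] at hv
    obtain ⟨t, ht, d, rfl⟩ := Submodule.exists_of_mem_sup_span_singleton hv
    obtain ⟨s, hs, c, rfl⟩ := Submodule.exists_of_mem_sup_span_singleton ht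
    exact ⟨s, hs, c, d, rfl⟩
  have left_mul {r s v w : R} {c d : ℤ} (hr : r ∈ J) (hs : s ∈ J ^ 3) (hv : r * v = 0) :
      r * (s + c * v + d * w) = d * (r * w) := by
    rw [mul_add, mul_add, z13 hr hs, ← mul_assoc r (c : R), ← (Int.cast_commute c r).eq,
      ← mul_assoc r (d : R), ← (Int.cast_commute d r).eq, mul_assoc, hv]
    noncomm_ring
  have right_mul {r s v w : R} {c d : ℤ} (hr : r ∈ J) (hs : s ∈ J ^ 3) (hv : v * r = 0) :
      (s + c * v + d * w) * r = d * (w * r) := by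
    rw [add_mul, add_mul, z31 hs hr, mul_assoc, hv]
    noncomm_ring
  -- Expressing `u * b` through `b * a` and `a * u` gives `a * (a * u) ≠ 0`.
  have haau : a * (a * u) ≠ 0 := by
    intro h
    obtain ⟨s, hs, c, d, hcd⟩ := dec hub gen1
    apply haub
    rw [mul_assoc, hcd, left_mul ha hs ha_ba, h, mul_zero]
  -- Expressing `a * u` through `b * a` and `u * b` gives `u * b * b ≠ 0`.
  have hubb : u * b * b ≠ 0 := by
    intro h
    obtain ⟨s, hs, c, d, hcd⟩ := dec hau gen2
    apply haub
    rw [hcd, right_mul hb hs hba_b, h, mul_zero]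
  have hbub : b * u * b ≠ 0 := fun h => hubb (ws hub hb (by rw [← mul_assoc]; exact h))
  -- Since `a * (b * u) = 0`, the element `b * u` is a multiple of `b * a` modulo `J ^ 3`.
  obtain ⟨s, hs, c, d, hcd⟩ := dec hbu gen1
  have hd : (d : R) * (a * (a * u)) = 0 := by
    rw [← left_mul ha hs ha_ba (c := c), ← hcd, ← mul_assoc, hab, zero_mul]
  have hdJ := hJ.mem_of_mul_eq_zero_left hd haau
  apply hbub
  rw [hcd, right_mul hb hs hba_b]
  exact z13 hdJ (mul_mem_pow_succ hau hb)

end IsNilpotentLocalRadical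

/-! ### One-dimensional layers of the radical -/

namespace IsNilpotentLocalRadical

variable {R : Type*} [Ring R] {J : Submodule ℤ R}

/-- If `J ^ m` is generated by one element modulo `J ^ (m + 1)`, then that element can be chosen to
be the `m`-th power of an element of `J`, unless `J ^ (m + 1) = 0`.

Choose `x` with `x * w ∉ J ^ (m + 2)`. Any product of `m` factors that is nonzero modulo
`J ^ (m + 1)` stays nonzero after multiplication by `x` on the left and after deletion of the last
factor, so all factors can be exchanged for `x`. -/
lemma exists_pow_notMem (hJ : IsNilpotentLocalRadical J) {m : ℕ} (hm : 1 ≤ m) {w : R}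
    (hwm : w ∈ J ^ m) (hw : J ^ m ≤ J ^ (m + 1) ⊔ Submodule.span ℤ {w}) (hm1 : J ^ (m + 1) ≠ ⊥) :
    ∃ x ∈ J, x ^ m ∉ J ^ (m + 1) := by
  have hlt := hJ.pow_succ_lt (by omega) hm1
  obtain ⟨x, hx, v, hv, hxv⟩ : ∃ x ∈ J, ∃ v ∈ J ^ m, x * v ∉ J ^ (m + 2) := by
    by_contra! h
    refine hlt.not_ge ?_
    rw [pow_succ' J m]
    exact Submodule.mul_le.2 h
  have hxw : x * w ∉ J ^ (m + 2) := by
    intro h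
    obtain ⟨s, hs, c, rfl⟩ := Submodule.exists_of_mem_sup_span_singleton (hw hv)
    apply hxv
    rw [mul_add, ← mul_assoc, ← (Int.cast_commute c x).eq, mul_assoc]
    exact Submodule.add_mem _ (mul_mem_pow_succ' hx hs) (hJ.pow_mul_mem_left _ _ h)
  have step {t : R} (ht : t ∈ J ^ m) (ht' : t ∉ J ^ (m + 1)) : x * t ∉ J ^ (m + 2) := by
    intro h
    obtain ⟨s, hs, c, rfl⟩ := Submodule.exists_of_mem_sup_span_singleton (hw ht)
    have hc : IsUnit (c : R) := hJ.isUnit_of_notMem _ fun hc =>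
      ht' (Submodule.add_mem _ hs (mul_mem_pow_succ' hc hwm))
    rw [mul_add, ← mul_assoc, ← (Int.cast_commute c x).eq, mul_assoc] at h
    obtain ⟨u, hu⟩ := hc
    have h2 : (u : R) * (x * w) ∈ J ^ (m + 2) := by
      rw [hu]
      exact (Submodule.add_mem_iff_right _ (mul_mem_pow_succ' hx hs)).1 h
    apply hxw
    rw [← Units.inv_mul_cancel_left u (x * w)]
    exact hJ.pow_mul_mem_left _ _ h2
  refine ⟨x, hx, ?_⟩
  have key : ∀ i ≤ m, ∃ t ∈ J ^ (m - i), x ^ i * t ∉ J ^ (m + 1) := by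
    intro i
    induction i with
    | zero =>
      intro _
      by_contra! h
      have h0 : J ^ m ≤ J ^ (m + 1) := fun t ht => by simpa using h t (by simpa using ht)
      exact (hJ.pow_succ_lt hm fun h => hm1 (by rw [pow_succ, h, Submodule.bot_mul])).not_ge h0
    | succ i ih =>
      intro hi
      obtain ⟨t, ht, hxt⟩ := ih (by omega)
      have hxi : x ^ i * t ∈ J ^ m := by
        have := mul_mem_pow (Submodule.pow_mem_pow J hx i) ht
        rwa [show i + (m - i) = m by omega] at this
      have h1 := step hxi hxt
      by_contra! h
      apply h1
      rw [show m - i = m - (i + 1) + 1 by omega, pow_succ] at ht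
      rw [← mul_assoc, ← pow_succ']
      refine Submodule.mul_induction_on ht (fun p hp q hq => ?_) (fun p q hp hq => ?_)
      · rw [← mul_assoc]
        exact mul_mem_pow_succ (h p hp) hq
      · rw [mul_add]
        exact Submodule.add_mem _ hp hq
  obtain ⟨t, -, ht⟩ := key m le_rfl
  intro h
  obtain ⟨k, rfl⟩ : ∃ k, m = k + 1 := ⟨m - 1, by omega⟩
  exact ht (hJ.pow_mul_mem_right _ t h)

/-- A generator `x ^ m` of `J ^ m` modulo `J ^ (m + 1)` generates all higher layers. -/
lemma pow_succ_le_sup_span (hJ : IsNilpotentLocalRadical J) {m : ℕ} (hm : 1 ≤ m) {x : R}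
    (hx : x ∈ J) (h : J ^ m ≤ J ^ (m + 1) ⊔ Submodule.span ℤ {x ^ m}) :
    J ^ (m + 1) ≤ J ^ (m + 2) ⊔ Submodule.span ℤ {x ^ (m + 1)} := by
  have span_mem {n : ℕ} {y : R} (c : ℤ) {s : R} (hs : s ∈ J ^ n) :
      s + c * y ∈ J ^ n ⊔ Submodule.span ℤ {y} := by
    refine Submodule.add_mem_sup hs ?_
    rw [← zsmul_eq_mul]
    exact Submodule.smul_mem _ _ (Submodule.mem_span_singleton_self y)
  rw [pow_succ]
  refine Submodule.mul_le.2 fun v hv j hj => ?_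
  obtain ⟨s, hs, c, rfl⟩ := Submodule.exists_of_mem_sup_span_singleton (h hv)
  obtain ⟨k, rfl⟩ : ∃ k, m = k + 1 := ⟨m - 1, by omega⟩
  obtain ⟨s', hs', c', hc'⟩ := Submodule.exists_of_mem_sup_span_singleton
    (h (mul_mem_pow_succ (Submodule.pow_mem_pow J hx k) hj))
  have h1 : (s + c * x ^ (k + 1)) * j
      = s * j + c * (x * s') + ((c * c' : ℤ) : R) * x ^ (k + 1 + 1) := by
    have h2 : x ^ (k + 1) * j = x * s' + c' * x ^ (k + 2) := by
      rw [pow_succ', mul_assoc, hc', mul_add, ← mul_assoc, ← (Int.cast_commute c' x).eq, mul_assoc,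
        ← pow_succ']
    rw [add_mul, mul_assoc, h2, mul_add, add_assoc, ← mul_assoc (c : R) (c' : R), Int.cast_mul]
  rw [h1]
  exact span_mem _ (Submodule.add_mem _ (mul_mem_pow_succ hs hj)
    (hJ.pow_mul_mem_left _ _ (mul_mem_pow_succ' hx hs')))

/-- If `x ^ m` generates `J ^ m` modulo `J ^ (m + 1)`, then `J ^ m = x ^ m * ℤ[x]`. -/
lemma exists_eq_pow_mul (hJ : IsNilpotentLocalRadical J) {m : ℕ} (hm : 1 ≤ m) {x : R}
    (hx : x ∈ J) (h : J ^ m ≤ J ^ (m + 1) ⊔ Submodule.span ℤ {x ^ m}) {n : ℕ} (hn : m ≤ n) {v : R}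
    (hv : v ∈ J ^ n) : ∃ σ ∈ Algebra.adjoin ℤ {x}, v = x ^ n * σ := by
  have gen : ∀ k, m ≤ k → J ^ k ≤ J ^ (k + 1) ⊔ Submodule.span ℤ {x ^ k} := by
    intro k hk
    induction k, hk using Nat.le_induction with
    | base => exact h
    | succ k hk ih => exact hJ.pow_succ_le_sup_span (hm.trans hk) hx ih
  obtain ⟨N, hN⟩ := hJ.exists_pow_eq_bot
  have key : ∀ d n, m ≤ n → N ≤ n + d → ∀ v ∈ J ^ n, ∃ σ ∈ Algebra.adjoin ℤ {x},
      v = x ^ n * σ := by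
    intro d
    induction d with
    | zero =>
      intro n hn hNn v hv
      refine ⟨0, Subalgebra.zero_mem _, ?_⟩
      obtain ⟨k, rfl⟩ := Nat.exists_eq_add_of_le (by simpa using hNn)
      rw [pow_add, hN, Submodule.bot_mul, Submodule.mem_bot] at hv
      simp [hv]
    | succ d ih =>
      intro n hn hNn v hv
      obtain ⟨s, hs, c, rfl⟩ := Submodule.exists_of_mem_sup_span_singleton (gen n hn hv)
      obtain ⟨σ, hσ, rfl⟩ := ih (n + 1) (by omega) (by omega) s hs
      refine ⟨x * σ + c, Subalgebra.add_mem _ (Subalgebra.mul_mem _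
        (Algebra.self_mem_adjoin_singleton ℤ x) hσ) (Subalgebra.intCast_mem _ c), ?_⟩
      rw [mul_add, pow_succ, mul_assoc, (Int.cast_commute c (x ^ n)).eq]
  exact key N n hn (by omega) v hv

end IsNilpotentLocalRadical

/-! ### Rings with principal powers of the radical -/

/-- From the third power on, the powers of the radical `J` are principal with generators in the
commutative subring `ℤ[x]`: `J ^ n = x ^ n * ℤ[x]` for `n ≥ 3`. -/
structure IsPowerGenerator {R : Type*} [Ring R] (J : Submodule ℤ R) (x : R) : Prop where
  mem : x ∈ J
  exists_eq_pow_mul : ∀ n, 3 ≤ n → ∀ v ∈ J ^ n, ∃ σ ∈ Algebra.adjoin ℤ {x}, v = x ^ n * σ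

/-- `t` is annihilated by `J` from both sides. -/
def IsSocleElement {R : Type*} [Ring R] (J : Submodule ℤ R) (t : R) : Prop :=
  ∀ j ∈ J, j * t = 0 ∧ t * j = 0

/-- The elements `l` of `J` with `l * x ^ 2 = 0`; they complement `x * ℤ[x]` in `J`. -/
def sqAnnihilator {R : Type*} [Ring R] (J : Submodule ℤ R) (x : R) : Submodule ℤ R :=
  J ⊓ LinearMap.ker (LinearMap.mulRight ℤ (x ^ 2))

lemma mem_sqAnnihilator {R : Type*} [Ring R] {J : Submodule ℤ R} {x l : R} :
    l ∈ sqAnnihilator J x ↔ l ∈ J ∧ l * x ^ 2 = 0 := by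
  simp [sqAnnihilator]

lemma commute_of_mem_adjoin_singleton {R : Type*} [Ring R] {x σ τ : R}
    (hσ : σ ∈ Algebra.adjoin ℤ {x}) (hτ : τ ∈ Algebra.adjoin ℤ {x}) : Commute σ τ := by
  rw [Algebra.adjoin_singleton_eq_range_aeval] at hσ hτ
  obtain ⟨p, rfl⟩ := hσ
  obtain ⟨q, rfl⟩ := hτ
  change _ * _ = _ * _
  simp only [AlgHom.toRingHom_eq_coe, RingHom.coe_coe]
  rw [← map_mul, ← map_mul, mul_comm]

namespace IsPowerGenerator

variable {R : Type*} [Ring R] {J : Submodule ℤ R} {x : R}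

lemma commute_left {σ : R} (hσ : σ ∈ Algebra.adjoin ℤ {x}) : Commute x σ :=
  commute_of_mem_adjoin_singleton (Algebra.self_mem_adjoin_singleton ℤ x) hσ

lemma mul_mem_J (hJ : IsNilpotentLocalRadical J) (hx : IsPowerGenerator J x) (σ : R) :
    x * σ ∈ J :=
  hJ.mul_mem_right σ x hx.mem

/-- An element of `J ^ n` lies in `x ^ n * ℤ[x]` up to an element of the annihilator of `x ^ 2`. -/
lemma exists_sub_mem (hJ : IsNilpotentLocalRadical J) (hx : IsPowerGenerator J x) {n : ℕ}
    (hn : 1 ≤ n) {v : R} (hv : v ∈ J ^ n) :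
    ∃ σ ∈ Algebra.adjoin ℤ {x}, v - x ^ n * σ ∈ sqAnnihilator J x := by
  obtain ⟨σ, hσ, h⟩ := hx.exists_eq_pow_mul (n + 2) (by omega) (v * x ^ 2)
    (IsNilpotentLocalRadical.mul_mem_pow hv (Submodule.pow_mem_pow J hx.mem 2))
  refine ⟨σ, hσ, mem_sqAnnihilator.2 ⟨?_, ?_⟩⟩
  · refine J.sub_mem (hJ.pow_le_self hn hv) (hJ.mul_mem_right _ _ ?_)
    exact hJ.pow_le_self hn (Submodule.pow_mem_pow J hx.mem n)
  · rw [sub_mul, h, mul_assoc, ((commute_left hσ).pow_left 2).eq.symm, ← mul_assoc, ← pow_add,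
      sub_self]

lemma exists_eq_add (hJ : IsNilpotentLocalRadical J) (hx : IsPowerGenerator J x) {v : R}
    (hv : v ∈ J) :
    ∃ σ ∈ Algebra.adjoin ℤ {x}, ∃ l ∈ sqAnnihilator J x, v = x * σ + l := by
  obtain ⟨σ, hσ, h⟩ := hx.exists_sub_mem hJ le_rfl (v := v) (by rwa [pow_one])
  rw [pow_one] at h
  exact ⟨σ, hσ, _, h, by abel⟩

lemma exists_eq_add_of_residue (hJ : IsNilpotentLocalRadical J) (hx : IsPowerGenerator J x)
    (hZ : ∀ r : R, ∃ n : ℤ, r - n ∈ J) (r : R) :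
    ∃ σ ∈ Algebra.adjoin ℤ {x}, ∃ l ∈ sqAnnihilator J x, r = σ + l := by
  obtain ⟨n, hn⟩ := hZ r
  obtain ⟨σ, hσ, l, hl, h⟩ := hx.exists_eq_add hJ hn
  refine ⟨n + x * σ, Subalgebra.add_mem _ (Subalgebra.intCast_mem _ n) (Subalgebra.mul_mem _
    (Algebra.self_mem_adjoin_singleton ℤ x) hσ), l, hl, ?_⟩
  rw [add_assoc, ← h]
  abel

lemma mul_sq_mul {l σ : R} (hl : l ∈ sqAnnihilator J x) (hσ : σ ∈ Algebra.adjoin ℤ {x}) :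
    l * σ * x ^ 2 = 0 := by
  rw [mul_assoc, ← ((commute_left hσ).pow_left 2).eq, ← mul_assoc, (mem_sqAnnihilator.1 hl).2,
    zero_mul]

/-- The left annihilator of `x ^ 2` in `J` is a two-sided ideal, so that reflexivity applies. -/
lemma sq_mul_eq_zero (hJ : IsNilpotentLocalRadical J) (hx : IsPowerGenerator J x)
    (hZ : ∀ r : R, ∃ n : ℤ, r - n ∈ J) (href : IsReflexiveRing R) {l : R}
    (hl : l ∈ sqAnnihilator J x) : x ^ 2 * l = 0 := by
  suffices h : ∀ r : R, l * r * x ^ 2 = 0 by simpa using href _ _ h 1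
  intro r
  obtain ⟨σ, hσ, m, hm, rfl⟩ := hx.exists_eq_add_of_residue hJ hZ r
  rw [mul_add, add_mul, mul_sq_mul hl hσ, mul_assoc l m, (mem_sqAnnihilator.1 hm).2]
  simp

/-- In `J ^ 3`, which lies in `ℤ[x]` and is annihilated by `sqAnnihilator J x` from both sides,
the socle is detected by multiplication with `x`. -/
lemma isSocleElement_of_mul_eq_zero (hJ : IsNilpotentLocalRadical J) (hx : IsPowerGenerator J x)
    (hZ : ∀ r : R, ∃ n : ℤ, r - n ∈ J) (href : IsReflexiveRing R) {v : R} (hv : v ∈ J ^ 3)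
    (h : x * v = 0) : IsSocleElement J v := by
  obtain ⟨σ, hσ, rfl⟩ := hx.exists_eq_pow_mul 3 le_rfl v hv
  have hc : Commute x (x ^ 3 * σ) := ((Commute.refl x).pow_right 3).mul_right (commute_left hσ)
  intro j hj
  obtain ⟨τ, hτ, l, hl, rfl⟩ := hx.exists_eq_add hJ hj
  have h1 : l * (x ^ 3 * σ) = 0 := by
    rw [pow_succ x 2, ← mul_assoc, ← mul_assoc, (mem_sqAnnihilator.1 hl).2]
    simp
  have h2 : x ^ 3 * σ * l = 0 := by
    rw [((commute_left hσ).pow_left 3).eq, pow_succ', mul_assoc, mul_assoc,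
      hx.sq_mul_eq_zero hJ hZ href hl]
    simp
  constructor
  · rw [add_mul, h1, (commute_left hτ).eq, mul_assoc, h]
    simp
  · rw [mul_add, h2, ← mul_assoc, ← hc.eq, h]
    simp

lemma _root_.IsSocleElement.mul_left (hJ : IsNilpotentLocalRadical J) {t : R}
    (ht : IsSocleElement J t) (r : R) : IsSocleElement J (r * t) := fun j hj => by
  rw [← mul_assoc, (ht _ (hJ.mul_mem_right r j hj)).1]
  constructor
  · rfl
  · rw [mul_assoc, (ht j hj).2, mul_zero]

section Products

variable (hJ : IsNilpotentLocalRadical J) (hx : IsPowerGenerator J x)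
  (hZ : ∀ r : R, ∃ n : ℤ, r - n ∈ J) (href : IsReflexiveRing R)

include hJ hx hZ href

/-- Products of three factors from `J`, one of which annihilates `x ^ 2`, lie in the socle. -/
lemma isSocleElement_left {l j j' : R} (hl : l ∈ sqAnnihilator J x) (hj : j ∈ J) (hj' : j' ∈ J) :
    IsSocleElement J (l * j * j') := by
  have hlJ := (mem_sqAnnihilator.1 hl).1
  refine hx.isSocleElement_of_mul_eq_zero hJ hZ href
    (IsNilpotentLocalRadical.mul_mem_pow_succ (IsNilpotentLocalRadical.mul_mem_sq hlJ hj) hj') ?_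
  have h1 : IsSocleElement J (x * l * j) := by
    refine hx.isSocleElement_of_mul_eq_zero hJ hZ href (IsNilpotentLocalRadical.mul_mem_pow_succ
      (IsNilpotentLocalRadical.mul_mem_sq hx.mem hlJ) hj) ?_
    rw [← mul_assoc, ← mul_assoc, ← pow_two, hx.sq_mul_eq_zero hJ hZ href hl, zero_mul]
  rw [← mul_assoc, ← mul_assoc, (h1 j' hj').2]

lemma isSocleElement_mid {l j j' : R} (hl : l ∈ sqAnnihilator J x) (hj : j ∈ J) (hj' : j' ∈ J) :
    IsSocleElement J (j * l * j') := by
  have hlJ := (mem_sqAnnihilator.1 hl).1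
  refine hx.isSocleElement_of_mul_eq_zero hJ hZ href
    (IsNilpotentLocalRadical.mul_mem_pow_succ (IsNilpotentLocalRadical.mul_mem_sq hj hlJ) hj') ?_
  obtain ⟨σ, hσ, m, hm, rfl⟩ := hx.exists_eq_add hJ hj
  have h1 := (hx.isSocleElement_left hJ hZ href hm hlJ hj' x hx.mem).1
  have h2 : x * ((x * σ + m) * l * j') = σ * (x ^ 2 * l) * j' + x * (m * l * j') := by
    have h3 : σ * x ^ 2 = x * (x * σ) := by
      rw [← ((commute_left hσ).pow_left 2).eq, pow_two, mul_assoc]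
    rw [← mul_assoc σ, h3]
    noncomm_ring
  rw [h2, h1, hx.sq_mul_eq_zero hJ hZ href hl]
  simp

lemma isSocleElement_right {l j j' : R} (hl : l ∈ sqAnnihilator J x) (hj : j ∈ J) (hj' : j' ∈ J) :
    IsSocleElement J (j * j' * l) := by
  have hlJ := (mem_sqAnnihilator.1 hl).1
  have h3 : j * j' * l ∈ J ^ 3 :=
    IsNilpotentLocalRadical.mul_mem_pow_succ (IsNilpotentLocalRadical.mul_mem_sq hj hj') hlJ
  refine hx.isSocleElement_of_mul_eq_zero hJ hZ href h3 ?_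
  obtain ⟨σ, hσ, h⟩ := hx.exists_eq_pow_mul 3 le_rfl _ h3
  have hc : Commute x (x ^ 3 * σ) := ((Commute.refl x).pow_right 3).mul_right (commute_left hσ)
  rw [h, hc.eq, ← h, mul_assoc, mul_assoc, ← mul_assoc j',
    (hx.isSocleElement_mid hJ hZ href hl hj' hx.mem j hj).1]

/-- Reversibility of `s * x = 0`, provided that `s` times the annihilator of `x ^ 2` times `x`
vanishes. -/
lemma mul_eq_zero_swap {s : R} (hs : s * x = 0)
    (hsl : ∀ l ∈ sqAnnihilator J x, s * l * x = 0) : x * s = 0 := by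
  suffices h : ∀ r : R, s * r * x = 0 by simpa using href _ _ h 1
  intro r
  obtain ⟨σ, hσ, m, hm, rfl⟩ := hx.exists_eq_add_of_residue hJ hZ r
  rw [mul_add, add_mul, hsl m hm, mul_assoc s σ, ← (commute_left hσ).eq, ← mul_assoc, hs]
  simp

lemma sq_mul_mul_eq_zero {σ l : R} (hσ : σ ∈ Algebra.adjoin ℤ {x}) (hl : l ∈ sqAnnihilator J x) :
    x ^ 2 * σ * l = 0 := by
  rw [((commute_left hσ).pow_left 2).eq, mul_assoc, hx.sq_mul_eq_zero hJ hZ href hl, mul_zero]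

/-- Writing `x * l * x = x ^ 3 * σ`, the element `s = x * l - x ^ 2 * σ` satisfies `s * x = 0`, and
reflexivity turns this into `x * s = 0`. -/
lemma mul_mul_self_eq_zero {l : R} (hl : l ∈ sqAnnihilator J x) : x * l * x = 0 := by
  have hlJ := (mem_sqAnnihilator.1 hl).1
  obtain ⟨σ, hσ, h⟩ := hx.exists_eq_pow_mul 3 le_rfl (x * l * x)
    (IsNilpotentLocalRadical.mul_mem_pow_succ (IsNilpotentLocalRadical.mul_mem_sq hx.mem hlJ)
      hx.mem)
  have hs : (x * l - x ^ 2 * σ) * x = 0 := by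
    rw [sub_mul, h, mul_assoc (x ^ 2), ← (commute_left hσ).eq, ← mul_assoc, ← pow_succ, sub_self]
  have h1 := hx.mul_eq_zero_swap hJ hZ href hs fun m hm => by
    have h2 := (hx.isSocleElement_left hJ hZ href hl (mem_sqAnnihilator.1 hm).1 hx.mem x hx.mem).1
    rw [sub_mul, hx.sq_mul_mul_eq_zero hJ hZ href hσ hm, sub_zero, mul_assoc x l, mul_assoc x, h2]
  rw [h, pow_succ', mul_assoc]
  rw [mul_sub, ← mul_assoc, ← pow_two, hx.sq_mul_eq_zero hJ hZ href hl, zero_sub, neg_eq_zero] at h1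
  exact h1

/-- Writing `l * m * x = x ^ 3 * σ`, reflexivity is applied to `l * m - x ^ 2 * σ` and `x`. -/
lemma mul_mul_comm {l m : R} (hl : l ∈ sqAnnihilator J x) (hm : m ∈ sqAnnihilator J x) :
    l * m * x = x * l * m := by
  have hlJ := (mem_sqAnnihilator.1 hl).1
  have hmJ := (mem_sqAnnihilator.1 hm).1
  obtain ⟨σ, hσ, h⟩ := hx.exists_eq_pow_mul 3 le_rfl (l * m * x)
    (IsNilpotentLocalRadical.mul_mem_pow_succ (IsNilpotentLocalRadical.mul_mem_sq hlJ hmJ)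
      hx.mem)
  have hs : (l * m - x ^ 2 * σ) * x = 0 := by
    rw [sub_mul, h, mul_assoc (x ^ 2), ← (commute_left hσ).eq, ← mul_assoc, ← pow_succ, sub_self]
  have h1 := hx.mul_eq_zero_swap hJ hZ href hs fun n hn => by
    have h2 := (hx.isSocleElement_left hJ hZ href hm (mem_sqAnnihilator.1 hn).1 hx.mem l hlJ).1
    rw [sub_mul, hx.sq_mul_mul_eq_zero hJ hZ href hσ hn, sub_zero, mul_assoc l m, mul_assoc l, h2]
  rw [mul_sub, sub_eq_zero, ← mul_assoc, ← mul_assoc, ← pow_succ'] at h1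
  rw [h1, h]

/-- The product of three elements of `J = x * ℤ[x] + sqAnnihilator J x`, expanded. -/
lemma mul_mul_expand {ρ σ τ l m n : R} (hρ : ρ ∈ Algebra.adjoin ℤ {x})
    (hσ : σ ∈ Algebra.adjoin ℤ {x})
    (hl : l ∈ sqAnnihilator J x) (hm : m ∈ sqAnnihilator J x) (hn : n ∈ sqAnnihilator J x) :
    (x * ρ + l) * (x * σ + m) * (x * τ + n) = σ * (x * (x * ρ * (x * τ))) + x * ρ * m * n
      + l * (x * σ) * n + l * m * (x * τ) + l * m * n := by
  have h1 : x * ρ * (x * σ) * n = 0 := by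
    have : x * ρ * (x * σ) = x ^ 2 * (ρ * σ) := by
      rw [mul_assoc x ρ, ← mul_assoc ρ x, ← (commute_left hρ).eq]
      noncomm_ring
    rw [this, hx.sq_mul_mul_eq_zero hJ hZ href (Subalgebra.mul_mem _ hρ hσ) hn]
  have h2 : x * ρ * m * (x * τ) = 0 := by
    rw [(commute_left hρ).eq, mul_assoc ρ, mul_assoc, ← mul_assoc (x * m),
      hx.mul_mul_self_eq_zero hJ hZ href hm]
    simp
  have h3 : l * (x * σ) * (x * τ) = 0 := by
    have : l * (x * σ) * (x * τ) = l * x ^ 2 * (σ * τ) := by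
      rw [mul_assoc, mul_assoc x σ, ← mul_assoc σ x, ← (commute_left hσ).eq]
      noncomm_ring
    rw [this, (mem_sqAnnihilator.1 hl).2, zero_mul]
  have h4 : x * ρ * (x * σ) * (x * τ) = σ * (x * (x * ρ * (x * τ))) := by
    have e1 := (commute_left hσ).eq
    have e2 := (commute_of_mem_adjoin_singleton hρ hσ).eq
    have e3 : Commute σ (x * ρ) := (commute_left hσ).symm.mul_right
      (commute_of_mem_adjoin_singleton hσ hρ)
    have e4 : Commute x (x * ρ) := (Commute.refl x).mul_right (commute_left hρ)
    have e5 : x * ρ * (x * σ) = σ * (x * (x * ρ)) := by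
      rw [e1, ← mul_assoc, ← (e3.eq), mul_assoc, ← e4.eq]
    rw [e5]
    noncomm_ring
  calc _ = x * ρ * (x * σ) * (x * τ) + x * ρ * (x * σ) * n + x * ρ * m * (x * τ) + x * ρ * m * n
      + l * (x * σ) * (x * τ) + l * (x * σ) * n + l * m * (x * τ) + l * m * n := by noncomm_ring
    _ = _ := by rw [h1, h2, h3, h4]; abel

/-- The case in which already `J ^ 2 = x ^ 2 * ℤ[x]`: the annihilator of `x ^ 2` then
annihilates `J ^ 2`. -/
lemma mul_eq_zero_of_sq
    (h2 : ∀ v ∈ J ^ 2, ∃ σ ∈ Algebra.adjoin ℤ {x}, v = x ^ 2 * σ) {a b : R}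
    (ha : a ∈ J) (hb : b ∈ J) (hab : a * b = 0) : b * a = 0 := by
  by_contra hba
  obtain ⟨u, hu, haub⟩ := IsNilpotentLocalRadical.exists_mul_mul_ne_zero href hZ hab hba
  have zr {s l : R} (hs : s ∈ J ^ 2) (hl : l ∈ sqAnnihilator J x) : s * l = 0 := by
    obtain ⟨σ, hσ, rfl⟩ := h2 s hs
    exact hx.sq_mul_mul_eq_zero hJ hZ href hσ hl
  have zl {s l : R} (hs : s ∈ J ^ 2) (hl : l ∈ sqAnnihilator J x) : l * s = 0 := by
    obtain ⟨σ, hσ, rfl⟩ := h2 s hs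
    rw [← mul_assoc, (mem_sqAnnihilator.1 hl).2, zero_mul]
  obtain ⟨ρ, hρ, l, hl, rfl⟩ := hx.exists_eq_add hJ ha
  obtain ⟨σ, hσ, m, hm, rfl⟩ := hx.exists_eq_add hJ hu
  obtain ⟨τ, -, n, hn, rfl⟩ := hx.exists_eq_add hJ hb
  have hlJ := (mem_sqAnnihilator.1 hl).1
  have hmJ := (mem_sqAnnihilator.1 hm).1
  have hxρ := hx.mul_mem_J hJ ρ
  have hxσ := hx.mul_mem_J hJ σ
  have hxτ := hx.mul_mem_J hJ τ
  open IsNilpotentLocalRadical in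
  rw [hx.mul_mul_expand hJ hZ href hρ hσ hl hm hn, zr (mul_mem_sq hxρ hmJ) hn,
    zr (mul_mem_sq hlJ hxσ) hn, mul_assoc l m, zl (mul_mem_sq hmJ hxτ) hl,
    zr (mul_mem_sq hlJ hmJ) hn] at haub
  apply haub
  have h5 : x * ((x * ρ + l) * (x * τ + n)) = x * (x * ρ * (x * τ)) := by
    have e1 : x * l * (x * τ) = 0 := by
      rw [← mul_assoc, hx.mul_mul_self_eq_zero hJ hZ href hl, zero_mul]
    have e2 : x * (x * ρ) * n = 0 := zr (IsNilpotentLocalRadical.mul_mem_sq hx.mem hxρ) hn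
    have e3 : x * l * n = 0 := zr (IsNilpotentLocalRadical.mul_mem_sq hx.mem hlJ) hn
    calc _ = x * (x * ρ * (x * τ)) + x * (x * ρ) * n + x * l * (x * τ) + x * l * n := by
            noncomm_ring
      _ = _ := by rw [e1, e2, e3]; abel
  rw [← h5, hab]
  simp

end Products

end IsPowerGenerator

/-! ### Radicals with two generators -/

lemma IsSocleElement.zsmul_eq_zero {R : Type*} [Ring R] {J : Submodule ℤ R} {t : R}
    (ht : IsSocleElement J t) {n : ℤ} (hn : (n : R) ∈ J) : n • t = 0 := by
  rw [zsmul_eq_mul]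
  exact (ht n hn).1

lemma IsNilpotentLocalRadical.zsmul_eq_zero {R : Type*} [Ring R] {J : Submodule ℤ R}
    (hJ : IsNilpotentLocalRadical J) {n : ℤ} (hn : (n : R) ∉ J) {t : R} (h : n • t = 0) :
    t = 0 := by
  rw [zsmul_eq_mul] at h
  exact (hJ.isUnit_of_notMem _ hn).mul_right_eq_zero.1 h

namespace IsPowerGenerator

variable {R : Type*} [Ring R] {J : Submodule ℤ R} {x : R}

section Products

variable (hJ : IsNilpotentLocalRadical J) (hx : IsPowerGenerator J x)
  (hZ : ∀ r : R, ∃ n : ℤ, r - n ∈ J) (href : IsReflexiveRing R)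

include hJ hx hZ href

/-- Products `s * l * j` and similar with `s ∈ J ^ 2`, `j ∈ J` and `l` an annihilator of `x ^ 2`
vanish, as they are products of `J` with the socle. -/
lemma sq_mul_mul_eq_zero_of_mem {s l j : R} (hs : s ∈ J ^ 2) (hl : l ∈ sqAnnihilator J x)
    (hj : j ∈ J) :
    s * l * j = 0 ∧ s * j * l = 0 ∧ l * s * j = 0 ∧ j * s * l = 0 ∧ l * j * s = 0 ∧
      j * l * s = 0 := by
  rw [pow_two] at hs
  refine Submodule.mul_induction_on hs (fun p hp q hq => ?_) (fun p q hp hq => ?_)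
  · refine ⟨?_, ?_, ?_, ?_, ?_, ?_⟩
    · rw [(hx.isSocleElement_right hJ hZ href hl hp hq j hj).2]
    · rw [mul_assoc, mul_assoc, ← mul_assoc q,
        (hx.isSocleElement_right hJ hZ href hl hq hj p hp).1]
    · rw [← mul_assoc, (hx.isSocleElement_left hJ hZ href hl hp hq j hj).2]
    · rw [mul_assoc, (hx.isSocleElement_right hJ hZ href hl hp hq j hj).1]
    · rw [← mul_assoc, (hx.isSocleElement_left hJ hZ href hl hj hp q hq).2]
    · rw [← mul_assoc, (hx.isSocleElement_mid hJ hZ href hl hj hp q hq).2]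
  · obtain ⟨h1, h2, h3, h4, h5, h6⟩ := hp
    obtain ⟨k1, k2, k3, k4, k5, k6⟩ := hq
    simp only [add_mul, mul_add, h1, h2, h3, h4, h5, h6, k1, k2, k3, k4, k5, k6, add_zero,
      and_self]

/-- Products of three factors, two of which annihilate `x ^ 2`, depend only on the factors
modulo `J ^ 2`. -/
lemma mul_mul_congr {y m n j : R} {l k : ℤ} (hy : y ∈ sqAnnihilator J x)
    (hm : m ∈ sqAnnihilator J x) (hm2 : m ∈ J ^ 2) (hn : n ∈ sqAnnihilator J x) (hn2 : n ∈ J ^ 2)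
    (hj : j ∈ J) :
    j * (l • y + m) * (k • y + n) = (l * k) • (j * y * y) ∧
    (l • y + m) * j * (k • y + n) = (l * k) • (y * j * y) ∧
    (l • y + m) * (k • y + n) * j = (l * k) • (y * y * j) := by
  have hmJ := (mem_sqAnnihilator.1 hm).1
  have hyJ := (mem_sqAnnihilator.1 hy).1
  have Z {s l j : R} (hs : s ∈ J ^ 2) (hl : l ∈ sqAnnihilator J x) (hj : j ∈ J) :=
    hx.sq_mul_mul_eq_zero_of_mem hJ hZ href hs hl hj
  obtain ⟨-, -, a1, -, a3, a4⟩ := Z hn2 hy hj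
  obtain ⟨b1, b2, -, b4, -, -⟩ := Z hm2 hy hj
  obtain ⟨c1, c2, -, c3, -, -⟩ := Z hm2 hn hj
  refine ⟨?_, ?_, ?_⟩ <;>
  simp only [add_mul, mul_add, smul_mul_assoc, mul_smul_comm, a1, a3, a4, b1, b2, b4,
    c1, c2, c3, smul_zero, add_zero, smul_smul, mul_comm]

/-- The case in which `J` is generated by `x` and `y` modulo `J ^ 2`, and `J ^ 5 = 0 ≠ J ^ 4`.

The trilinear products of `x` and `y` are governed by the three socle elements `x * y * y`,
`y * x * y` and `y * y * y`. -/
lemma mul_eq_zero_of_pair {y : R} (hy : y ∈ sqAnnihilator J x)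
    (hgen : J ≤ J ^ 2 ⊔ Submodule.span ℤ {x} ⊔ Submodule.span ℤ {y}) (h4 : J ^ 4 ≠ ⊥)
    (h5 : J ^ 5 = ⊥) {a b : R} (ha : a ∈ J) (hb : b ∈ J) (hab : a * b = 0) : b * a = 0 := by
  by_contra hba
  obtain ⟨u, hu, haub⟩ := IsNilpotentLocalRadical.exists_mul_mul_ne_zero href hZ hab hba
  have hyJ := (mem_sqAnnihilator.1 hy).1
  have dec {v : R} (hv : v ∈ J) : ∃ (α l : ℤ), ∃ σ ∈ Algebra.adjoin ℤ {x},
      ∃ m ∈ sqAnnihilator J x, m ∈ J ^ 2 ∧ v = x * (α + x * σ) + (l • y + m) := by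
    obtain ⟨t, ht, l, rfl⟩ := Submodule.exists_of_mem_sup_span_singleton (hgen hv)
    obtain ⟨s, hs, α, rfl⟩ := Submodule.exists_of_mem_sup_span_singleton ht
    obtain ⟨σ, hσ, h⟩ := hx.exists_sub_mem hJ (by norm_num) hs
    refine ⟨α, l, σ, hσ, _, h, Submodule.sub_mem _ hs
      (hJ.pow_mul_mem_right 1 _ (Submodule.pow_mem_pow J hx.mem 2)), ?_⟩
    rw [mul_add, (Int.cast_commute α x).eq, zsmul_eq_mul, pow_two]
    noncomm_ring
  have mem_adj (α : ℤ) {σ : R} (hσ : σ ∈ Algebra.adjoin ℤ {x}) :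
      (α : R) + x * σ ∈ Algebra.adjoin ℤ {x} :=
    Subalgebra.add_mem _ (Subalgebra.intCast_mem _ α) (Subalgebra.mul_mem _
        (Algebra.self_mem_adjoin_singleton ℤ x) hσ)
  have xmul (α : ℤ) (σ : R) : x * (α + x * σ) = α • x + x ^ 2 * σ := by
    rw [mul_add, ← (Int.cast_commute α x).eq, zsmul_eq_mul, pow_two, mul_assoc]
  obtain ⟨α, l, ρ, hρ, p, hp, hp2, rfl⟩ := dec ha
  obtain ⟨γ, k, σ, hσ, q, hq, hq2, rfl⟩ := dec hu
  obtain ⟨β, m, τ, hτ, r, hr, hr2, rfl⟩ := dec hb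
  have hmem (n : ℤ) {t : R} (ht : t ∈ sqAnnihilator J x) : n • y + t ∈ sqAnnihilator J x :=
    Submodule.add_mem _ (Submodule.smul_mem _ _ hy) ht
  have hmemJ (n : ℤ) {t : R} (ht : t ∈ sqAnnihilator J x) : n • y + t ∈ J :=
    (mem_sqAnnihilator.1 (hmem n ht)).1
  have C {m n j : R} {l k : ℤ} (hm : m ∈ sqAnnihilator J x) (hm2 : m ∈ J ^ 2)
      (hn : n ∈ sqAnnihilator J x) (hn2 : n ∈ J ^ 2) (hj : j ∈ J) :=
    hx.mul_mul_congr hJ hZ href (l := l) (k := k) hy hm hm2 hn hn2 hj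
  have hxσl {σ t : R} (hσ : σ ∈ Algebra.adjoin ℤ {x}) (ht : t ∈ sqAnnihilator J x) :
      x ^ 2 * σ * t = 0 := hx.sq_mul_mul_eq_zero hJ hZ href hσ ht
  have hlx {t : R} (ht : t ∈ sqAnnihilator J x) : t * x ^ 2 = 0 := (mem_sqAnnihilator.1 ht).2
  have hxx {t : R} (ht : t ∈ sqAnnihilator J x) : x * t * x = 0 :=
    hx.mul_mul_self_eq_zero hJ hZ href ht
  have hf : IsSocleElement J (x * y * y) := hx.isSocleElement_right hJ hZ href hy hx.mem hyJ
  have hg : IsSocleElement J (y * x * y) := hx.isSocleElement_right hJ hZ href hy hyJ hx.mem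
  have hh : IsSocleElement J (y * y * y) := hx.isSocleElement_right hJ hZ href hy hyJ hyJ
  have hyyx : y * y * x = x * y * y := hx.mul_mul_comm hJ hZ href hy hy
  have hxlxσ {t σ : R} (ht : t ∈ sqAnnihilator J x) : x * t * (x * σ) = 0 := by
    rw [← mul_assoc, hxx ht, zero_mul]
  -- the cubic products occurring below
  have PLL {α l k : ℤ} {σ s t : R} (hσ : σ ∈ Algebra.adjoin ℤ {x}) (hs : s ∈ sqAnnihilator J x)
      (hs2 : s ∈ J ^ 2) (ht : t ∈ sqAnnihilator J x) (ht2 : t ∈ J ^ 2) :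
      x * (α + x * σ) * (l • y + s) * (k • y + t) = (α * (l * k)) • (x * y * y) := by
    rw [xmul, add_mul, hxσl hσ (hmem l hs), add_zero, smul_mul_assoc, smul_mul_assoc,
      (C hs hs2 ht ht2 hx.mem).1, smul_smul]
  have LPL {α l k : ℤ} {σ s t : R} (hs : s ∈ sqAnnihilator J x)
      (hs2 : s ∈ J ^ 2) (ht : t ∈ sqAnnihilator J x) (ht2 : t ∈ J ^ 2) :
      (l • y + s) * (x * (α + x * σ)) * (k • y + t) = (α * (l * k)) • (y * x * y) := by
    rw [xmul, mul_add (l • y + s), ← mul_assoc _ (x ^ 2), hlx (hmem l hs), zero_mul, add_zero,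
      mul_smul_comm, smul_mul_assoc, (C hs hs2 ht ht2 hx.mem).2.1, smul_smul]
  have LLP {α l k : ℤ} {σ s t : R} (hs : s ∈ sqAnnihilator J x)
      (hs2 : s ∈ J ^ 2) (ht : t ∈ sqAnnihilator J x) (ht2 : t ∈ J ^ 2) :
      (l • y + s) * (k • y + t) * (x * (α + x * σ)) = (α * (l * k)) • (x * y * y) := by
    rw [xmul, mul_add, mul_assoc _ _ (x ^ 2 * σ), ← mul_assoc _ (x ^ 2), hlx (hmem k ht), zero_mul,
      mul_zero, add_zero, mul_smul_comm, (C hs hs2 ht ht2 hx.mem).2.2, smul_smul, hyyx]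
  have LLL {l k n : ℤ} {s t w : R} (hs : s ∈ sqAnnihilator J x) (hs2 : s ∈ J ^ 2)
      (ht : t ∈ sqAnnihilator J x) (ht2 : t ∈ J ^ 2) (hw : w ∈ sqAnnihilator J x)
      (hw2 : w ∈ J ^ 2) :
      (l • y + s) * (k • y + t) * (n • y + w) = (l * k * n) • (y * y * y) := by
    rw [(C hs hs2 ht ht2 (hmemJ n hw)).2.2, mul_add, mul_smul_comm,
      (hx.sq_mul_mul_eq_zero_of_mem hJ hZ href hw2 hy hyJ).2.2.2.2.1, add_zero, smul_smul]
  set P := x * ((α : R) + x * ρ) with hP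
  set Q := x * ((β : R) + x * τ) with hQ
  have z0 : (0 : R) ∈ sqAnnihilator J x := Submodule.zero_mem _
  have z2 : (0 : R) ∈ J ^ 2 := Submodule.zero_mem _
  have y1 : (1 : ℤ) • y + 0 = y := by simp
  have hE : P * Q + P * (m • y + r) + (l • y + p) * Q + (l • y + p) * (m • y + r) = 0 := by
    rw [← hab]
    simp only [add_mul, mul_add]
    abel
  -- Multiplying `a * b = 0` by `x` and by `y` gives three relations in the socle.
  have E0 : x * (P * Q) = -((l * m) • (x * y * y)) := by
    have e1 : x * P * (m • y + r) = 0 := by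
      rw [hP, ← mul_assoc, ← pow_two, hxσl (mem_adj α hρ) (hmem m hr)]
    have e2 : x * (l • y + p) * Q = 0 := hxlxσ (hmem l hp)
    have e3 := (C (l := l) (k := m) hp hp2 hr hr2 hx.mem).1
    rw [← e3, eq_neg_iff_add_eq_zero]
    calc _ = x * (P * Q + P * (m • y + r) + (l • y + p) * Q + (l • y + p) * (m • y + r))
          - x * P * (m • y + r) - x * (l • y + p) * Q := by noncomm_ring
      _ = 0 := by rw [hE, e1, e2]; simp
  have E1 : (α * m) • (y * x * y) + (β * l) • (x * y * y) + (l * m) • (y * y * y) = 0 := by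
    have e1 : y * P * Q = 0 := by
      have h1 : y * P * Q = y * x ^ 2 * ((α + x * ρ) * (β + x * τ)) := by
        rw [hP, hQ, mul_assoc, mul_assoc x, ← mul_assoc _ x (_ + _),
          ← (commute_left (mem_adj α hρ)).eq]
        noncomm_ring
      rw [h1, hlx hy, zero_mul]
    have e2 := LPL (α := α) (σ := ρ) (l := 1) (k := m) z0 z2 hr hr2
    have e3 := LLP (α := β) (σ := τ) (l := 1) (k := l) z0 z2 hp hp2
    have e4 := LLL (l := 1) (k := l) (n := m) z0 z2 hp hp2 hr hr2
    rw [y1, one_mul] at e2 e3 e4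
    rw [← hP] at e2
    rw [← hQ] at e3
    rw [← e2, ← e3, ← e4]
    calc _ = y * (P * Q + P * (m • y + r) + (l • y + p) * Q + (l • y + p) * (m • y + r))
          - y * P * Q := by noncomm_ring
      _ = 0 := by rw [hE, e1]; simp
  have E2 : (α * m) • (x * y * y) + (β * l) • (y * x * y) + (l * m) • (y * y * y) = 0 := by
    have e1 : P * Q * y = 0 := by
      have h1 : P * Q * y = x ^ 2 * ((α + x * ρ) * (β + x * τ)) * y := by
        rw [hP, hQ, mul_assoc x, ← mul_assoc _ x (_ + _), ← (commute_left (mem_adj α hρ)).eq]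
        noncomm_ring
      rw [h1, hxσl (Subalgebra.mul_mem _ (mem_adj α hρ) (mem_adj β hτ)) hy]
    have e2 := PLL (α := α) (σ := ρ) (l := m) (k := 1) hρ hr hr2 z0 z2
    have e3 := LPL (α := β) (σ := τ) (l := l) (k := 1) hp hp2 z0 z2
    have e4 := LLL (l := l) (k := m) (n := 1) hp hp2 hr hr2 z0 z2
    rw [y1, mul_one] at e2 e3 e4
    rw [← hP] at e2
    rw [← hQ] at e3
    rw [← e2, ← e3, ← e4]
    calc _ = (P * Q + P * (m • y + r) + (l • y + p) * Q + (l • y + p) * (m • y + r)) * y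
          - P * Q * y := by noncomm_ring
      _ = 0 := by rw [hE, e1]; simp
  have hU : (P + (l • y + p)) * (x * (γ + x * σ) + (k • y + q)) * (Q + (m • y + r))
      = (γ * (l * m)) • (y * x * y - x * y * y)
        + k • ((α * m) • (x * y * y) + (β * l) • (x * y * y) + (l * m) • (y * y * y)) := by
    rw [hx.mul_mul_expand hJ hZ href (mem_adj α hρ) (mem_adj γ hσ) (hmem l hp) (hmem k hq)
      (hmem m hr), ← hP, ← hQ, E0, PLL hρ hq hq2 hr hr2, LPL hp hp2 hr hr2, LLP hp hp2 hq hq2,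
      LLL hp hp2 hq hq2 hr hr2, add_mul, mul_neg, mul_neg, mul_smul_comm (l * m) (x * σ),
      mul_assoc x σ, (hf.mul_left hJ σ x hx.mem).1, ← zsmul_eq_mul]
    module
  apply haub
  rw [hU]
  by_cases hf0 : x * y * y = 0
  · -- Reflexivity turns `x * y * R * y = 0` into `y * x * y = 0`.
    have hg0 : y * x * y = 0 := by
      suffices h : ∀ r : R, x * y * r * y = 0 by
        have := href _ _ h 1
        rwa [mul_one, ← mul_assoc] at this
      intro r
      obtain ⟨n, hn⟩ := hZ r
      have h1 : x * y * r * y = x * (y * (r - n) * y) + n * (x * y * y) := by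
        have h2 := (Int.cast_commute n (x * y)).eq
        rw [← mul_assoc (n : R), h2]
        noncomm_ring
      rw [h1, hf0, (hx.isSocleElement_left hJ hZ href hy hn hyJ x hx.mem).1]
      simp
    rw [hf0, hg0] at E1
    rw [hf0, hg0]
    simp only [smul_zero, zero_add, sub_zero] at E1 ⊢
    rw [E1, smul_zero]
  · by_cases hα : (α : R) ∈ J
    · by_cases hβ : (β : R) ∈ J
      · -- Here `P` and `Q` lie in `J ^ 2`, whence `x * (P * Q)` lies in `J ^ 5 = 0`.
        have hPQ : x * (P * Q) = 0 := by
          have h1 {α : ℤ} {σ : R} (hα : (α : R) ∈ J) : x * (α + x * σ) ∈ J ^ 2 :=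
            IsNilpotentLocalRadical.mul_mem_sq hx.mem (J.add_mem hα (hx.mul_mem_J hJ σ))
          exact IsNilpotentLocalRadical.eq_zero_of_mem_pow h5
            (IsNilpotentLocalRadical.mul_mem_pow_succ' hx.mem
              (IsNilpotentLocalRadical.mul_mem_pow (h1 hα) (h1 hβ)))
        rw [hPQ, eq_comm, neg_eq_zero] at E0
        have hlm : ((l * m : ℤ) : R) ∈ J := by
          by_contra h
          exact hf0 (hJ.zsmul_eq_zero h E0)
        have hαm : ((α * m : ℤ) : R) ∈ J := by
          rw [Int.cast_mul]
          exact hJ.mul_mem_right _ _ hα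
        have hβl : ((β * l : ℤ) : R) ∈ J := by
          rw [Int.cast_mul]
          exact hJ.mul_mem_right _ _ hβ
        rw [mul_smul, smul_sub, hg.zsmul_eq_zero hlm, hf.zsmul_eq_zero hlm, hh.zsmul_eq_zero hlm,
          hf.zsmul_eq_zero hαm, hf.zsmul_eq_zero hβl]
        simp
      · have hα' : ((α * m : ℤ) : R) ∈ J := by
          rw [Int.cast_mul]
          exact hJ.mul_mem_right _ _ hα
        rw [hg.zsmul_eq_zero hα', zero_add] at E1
        rw [hf.zsmul_eq_zero hα', zero_add] at E2 ⊢
        have h1 : l • (y * x * y - x * y * y) = 0 := hJ.zsmul_eq_zero hβ (by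
          linear_combination (norm := module) E2 - E1)
        rw [E1, smul_zero, add_zero]
        linear_combination (norm := module) (γ * m) • h1
    · -- If `α` and `β` were both units, then `x * (P * Q) ∈ socle` would give `x ^ 4 = 0`.
      have hβ : (β : R) ∈ J := by
        by_contra hβ
        have hu : IsUnit ((α : R) * β + x * (α * τ + ρ * β + ρ * (x * τ))) := by
          refine hJ.isUnit_of_notMem _ fun h => ?_
          rw [Submodule.add_mem_iff_left _ (hx.mul_mem_J hJ _)] at h
          exact hJ.notMem_of_isUnit ((hJ.isUnit_of_notMem _ hα).mul (hJ.isUnit_of_notMem _ hβ)) h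
        have hx4 : x ^ 4 * ((α : R) * β + x * (α * τ + ρ * β + ρ * (x * τ))) = 0 := by
          have h1 : x * (x * (P * Q)) = 0 := by
            rw [E0, mul_neg, mul_smul_comm, (hf x hx.mem).1]
            simp
          rw [← h1, hP, hQ]
          have h2 := (commute_left (mem_adj α hρ)).eq
          have h3 := (Int.cast_commute α x).eq
          calc _ = x * (x * (x * (x * (α * β + x * α * τ + x * ρ * β + x * ρ * (x * τ))))) := by
                noncomm_ring
            _ = x * (x * (x * (x * ((α + x * ρ) * (β + x * τ))))) := by
                rw [← h3]; noncomm_ring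
            _ = x * (x * (x * (x * (α + x * ρ) * (β + x * τ)))) := by
                rw [mul_assoc x (α + x * ρ)]
            _ = _ := by
                rw [mul_assoc x (α + x * ρ) (x * (β + x * τ)), ← mul_assoc (α + x * ρ) x, ← h2]
        apply h4
        rw [hu.mul_left_eq_zero] at hx4
        rw [eq_bot_iff]
        intro v hv
        obtain ⟨σ, -, rfl⟩ := hx.exists_eq_pow_mul 4 (by norm_num) v hv
        simp [hx4]
      have hβ' : ((β * l : ℤ) : R) ∈ J := by
        rw [Int.cast_mul]
        exact hJ.mul_mem_right _ _ hβ
      rw [hf.zsmul_eq_zero hβ', add_zero] at E1 ⊢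
      rw [hg.zsmul_eq_zero hβ', add_zero] at E2
      have h1 : m • (y * x * y - x * y * y) = 0 := hJ.zsmul_eq_zero hα (by
        linear_combination (norm := module) E1 - E2)
      rw [E2, smul_zero, add_zero]
      linear_combination (norm := module) (γ * l) • h1

end Products

end IsPowerGenerator

/-! ### The local case and the reduction to it -/

namespace IsNilpotentLocalRadical

variable {R : Type*} [Ring R] {J : Submodule ℤ R}

/-- A one-dimensional layer `J ^ m / J ^ (m + 1)` followed by a nonzero one is generated by the
`m`-th power of an element of `J`. -/
lemma exists_pow_generator (hJ : IsNilpotentLocalRadical J)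
    (hZ : ∀ r : R, ∃ n : ℤ, r - n ∈ J) {m : ℕ} (hm : 1 ≤ m) {w : R}
    (hwm : w ∈ J ^ m) (hw : J ^ m ≤ J ^ (m + 1) ⊔ Submodule.span ℤ {w})
    (hm1 : J ^ (m + 1) ≠ ⊥) :
    ∃ x ∈ J, J ^ m ≤ J ^ (m + 1) ⊔ Submodule.span ℤ {x ^ m} := by
  obtain ⟨x, hx, hxm⟩ := hJ.exists_pow_notMem hm hwm hw hm1
  refine ⟨x, hx, hw.trans (Submodule.sup_span_singleton_le le_sup_left ?_)⟩
  obtain ⟨s, hs, c, hc⟩ :=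
    Submodule.exists_of_mem_sup_span_singleton (hw (Submodule.pow_mem_pow J hx m))
  have hcJ : (c : R) ∉ J := fun h => hxm (by
    rw [hc]
    exact Submodule.add_mem _ hs (mul_mem_pow_succ' h hwm))
  obtain ⟨u, hu⟩ := hJ.isUnit_of_notMem _ hcJ
  obtain ⟨n, hn⟩ := hZ (↑u⁻¹ : R)
  have hxs : x ^ m - s = u * w := by rw [hu, hc]; abel
  have hwx : w = (-(↑u⁻¹ * s) + (↑u⁻¹ - n) * x ^ m) + n • x ^ m := by
    rw [← Units.inv_mul_cancel_left u w, ← hxs, zsmul_eq_mul]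
    noncomm_ring
  rw [hwx]
  exact Submodule.add_mem_sup (Submodule.add_mem _
    (Submodule.neg_mem _ (hJ.pow_mul_mem_left m _ hs))
    (mul_mem_pow_succ' hn (Submodule.pow_mem_pow J hx m)))
    (Submodule.smul_mem _ _ (Submodule.mem_span_singleton_self _))

/-- A local ring of length at most seven with prime residue field. -/
lemma mul_eq_zero_of_residue_prime (hJ : IsNilpotentLocalRadical J) {ℓ : Submodule ℤ R → ℕ}
    (hℓ : StrictMono ℓ) (hℓ7 : ℓ ⊤ ≤ 7) (href : IsReflexiveRing R)
    (hZ : ∀ r : R, ∃ n : ℤ, r - n ∈ J) {a b : R} (hab : a * b = 0) : b * a = 0 := by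
  by_cases h4 : J ^ 4 = ⊥
  · exact hJ.mul_eq_zero_of_pow_four_eq_bot hℓ hℓ7 href hZ h4 hab
  by_contra hba
  have ha0 : a ≠ 0 := by rintro rfl; simp at hba
  have hb0 : b ≠ 0 := by rintro rfl; simp at hba
  have ha := hJ.mem_of_mul_eq_zero_left hab hb0
  have hb := hJ.mem_of_mul_eq_zero_right hab ha0
  have h3 : J ^ 3 ≠ ⊥ := fun h => h4 (by rw [pow_succ, h, Submodule.bot_mul])
  have h2 : J ^ 2 ≠ ⊥ := fun h => h3 (by rw [pow_succ, h, Submodule.bot_mul])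
  have h1 : J ≠ ⊥ := fun h => ha0 (by simpa [h] using ha)
  have lt21 : J ^ 2 < J := hJ.sq_lt h1
  have lt32 : J ^ 3 < J ^ 2 := hJ.pow_succ_lt (by norm_num) h2
  have lt43 : J ^ 4 < J ^ 3 := hJ.pow_succ_lt (by norm_num) h3
  have lt54 : J ^ 5 < J ^ 4 := hJ.pow_succ_lt (by norm_num) h4
  have ltop := hℓ hJ.lt_top
  by_cases hd2 : ∃ v ∈ J ^ 2, J ^ 2 ≤ J ^ 3 ⊔ Submodule.span ℤ {v}
  · obtain ⟨v, hv, hv2⟩ := hd2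
    obtain ⟨x, hx, hx2⟩ := hJ.exists_pow_generator hZ (by norm_num) hv hv2 h3
    have hgen : IsPowerGenerator J x := ⟨hx, fun n hn v hv =>
      hJ.exists_eq_pow_mul (by norm_num) hx hx2 (by omega) hv⟩
    exact hba (hgen.mul_eq_zero_of_sq hJ hZ href
      (fun v hv => hJ.exists_eq_pow_mul (by norm_num) hx hx2 le_rfl hv) ha hb hab)
  push Not at hd2
  -- A generator of `J` modulo `J ^ 2` would yield one of `J ^ 2` modulo `J ^ 3`.
  have hd1 (x : R) (hx : x ∈ J) : ¬ J ≤ J ^ 2 ⊔ Submodule.span ℤ {x} := fun h =>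
    hd2 (x ^ 2) (Submodule.pow_mem_pow J hx 2)
      (hJ.pow_succ_le_sup_span (m := 1) le_rfl hx (by simpa using h))
  have len2 : ℓ (J ^ 3) + 2 ≤ ℓ (J ^ 2) := by
    obtain ⟨v, hv, hv3⟩ := SetLike.exists_of_lt lt32
    have l1 := hℓ (Submodule.lt_sup_span_singleton hv3)
    have l2 := hℓ (lt_of_le_not_ge (Submodule.sup_span_singleton_le lt32.le hv) (hd2 v hv))
    omega
  have len1 {x : R} (hx : x ∈ J) (hx2 : x ∉ J ^ 2) :
      ℓ (J ^ 2) + 1 ≤ ℓ (J ^ 2 ⊔ Submodule.span ℤ {x}) ∧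
        J ^ 2 ⊔ Submodule.span ℤ {x} < J :=
    ⟨hℓ (Submodule.lt_sup_span_singleton hx2),
      lt_of_le_not_ge (Submodule.sup_span_singleton_le lt21.le hx) (hd1 x hx)⟩
  have l43 := hℓ lt43
  have hd3 : ∃ w ∈ J ^ 3, J ^ 3 ≤ J ^ 4 ⊔ Submodule.span ℤ {w} := by
    obtain ⟨w, hw, hw4⟩ := SetLike.exists_of_lt lt43
    refine ⟨w, hw, ?_⟩
    -- Otherwise the layers of `J` from the fourth power up to `R / J` have length at least
    -- `1`, `2`, `2`, `2`, `1`.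
    by_contra h
    obtain ⟨z, hz, hz2⟩ := SetLike.exists_of_lt lt21
    have k1 := hℓ (bot_lt_iff_ne_bot.2 h4)
    have k2 := hℓ (Submodule.lt_sup_span_singleton hw4)
    have k3 := hℓ (lt_of_le_not_ge (Submodule.sup_span_singleton_le lt43.le hw) h)
    have k4 := (len1 hz hz2).1
    have k5 := hℓ (len1 hz hz2).2
    omega
  obtain ⟨w, hw, hw3⟩ := hd3
  obtain ⟨x, hx, hx3⟩ := hJ.exists_pow_generator hZ (by norm_num) hw hw3 h4
  have hgen : IsPowerGenerator J x := ⟨hx, fun n hn v hv =>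
    hJ.exists_eq_pow_mul (by norm_num) hx hx3 hn hv⟩
  have hx2 : x ∉ J ^ 2 := by
    intro h
    have h0 : x ^ 3 ∈ J ^ 4 := by
      rw [pow_succ x 2]
      exact mul_mem_pow (Submodule.pow_mem_pow J hx 2) h
    exact lt43.not_ge (hx3.trans (Submodule.sup_span_singleton_le le_rfl h0))
  obtain ⟨k4, hlt⟩ := len1 hx hx2
  obtain ⟨y, hy, hyx⟩ := SetLike.exists_of_lt hlt
  have k5 := hℓ (Submodule.lt_sup_span_singleton hyx)
  have hle := Submodule.sup_span_singleton_le hlt.le hy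
  have k6 := hℓ.monotone hle
  have k7 := hℓ (bot_lt_iff_ne_bot.2 h4)
  -- The layers `R / J`, ..., `J ^ 4 / J ^ 5` have length at least `1`, `2`, `2`, `1`, `1`, which
  -- exhausts the length seven: `J ^ 5 = 0` and `J / J ^ 2` is spanned by `x` and `y`.
  have h5 : J ^ 5 = ⊥ := by
    by_contra h
    have k8 := hℓ (bot_lt_iff_ne_bot.2 h)
    have k9 := hℓ lt54
    omega
  have hJxy : J ≤ J ^ 2 ⊔ Submodule.span ℤ {x} ⊔ Submodule.span ℤ {y} := by
    by_contra h
    have k8 := hℓ (lt_of_le_not_ge hle h)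
    omega
  -- Correct `y` by a multiple of `x` so that it annihilates `x ^ 2`.
  obtain ⟨σ, hσ, l, hl, rfl⟩ := hgen.exists_eq_add hJ hy
  obtain ⟨τ, n, hτ⟩ : ∃ τ : R, ∃ n : ℤ, x * σ = x * τ + n * x ∧ x * τ ∈ J ^ 2 := by
    obtain ⟨n, hn⟩ := hZ σ
    refine ⟨σ - n, n, ?_, mul_mem_sq hx hn⟩
    rw [mul_sub, (Int.cast_commute n x).eq]
    abel
  refine hba (hgen.mul_eq_zero_of_pair hJ hZ href hl (hJxy.trans ?_) h4 h5 ha hb hab)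
  refine Submodule.sup_span_singleton_le le_sup_left ?_
  rw [hτ.1]
  refine Submodule.add_mem _ (Submodule.mem_sup_left (Submodule.add_mem_sup hτ.2 ?_))
    (Submodule.mem_sup_right (Submodule.mem_span_singleton_self l))
  rw [← zsmul_eq_mul]
  exact Submodule.smul_mem _ _ (Submodule.mem_span_singleton_self x)

/-- Reflexive local rings of length at most seven are reversible. -/
lemma isReversibleRing (hJ : IsNilpotentLocalRadical J) {ℓ : Submodule ℤ R → ℕ}
    (hℓ : StrictMono ℓ) (hℓ7 : ℓ ⊤ ≤ 7) (href : IsReflexiveRing R) : IsReversibleRing R := by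
  intro a b hab
  by_cases hZ : ∀ r : R, ∃ n : ℤ, r - n ∈ J
  · exact hJ.mul_eq_zero_of_residue_prime hℓ hℓ7 href hZ hab
  · push Not at hZ
    obtain ⟨g, hg⟩ := hZ
    exact hJ.mul_eq_zero_of_residue_ne_prime hℓ hℓ7 hg hab

end IsNilpotentLocalRadical

/-- In a finite ring every element has an idempotent power. -/
lemma exists_pow_isIdempotentElem {R : Type*} [Ring R] [Finite R] (r : R) :
    ∃ n ≠ 0, IsIdempotentElem (r ^ n) := by
  obtain ⟨m, n, hmn, h⟩ : ∃ m n : ℕ, m < n ∧ r ^ m = r ^ n := by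
    obtain ⟨i, j, hij, h⟩ := Finite.exists_ne_map_eq_of_infinite (fun k : ℕ => r ^ k)
    rcases lt_or_gt_of_ne hij with hlt | hlt
    · exact ⟨i, j, hlt, h⟩
    · exact ⟨j, i, hlt, h.symm⟩
  obtain ⟨d, hd, rfl⟩ : ∃ d, 0 < d ∧ n = m + d := ⟨n - m, by omega, by omega⟩
  have per : ∀ q k, m ≤ k → r ^ (k + q * d) = r ^ k := by
    intro q k hk
    induction q with
    | zero => simp
    | succ q ih =>
      obtain ⟨e, rfl⟩ := Nat.exists_eq_add_of_le hk
      rw [← ih, show m + e + (q + 1) * d = (m + d) + (e + q * d) by ring, pow_add, ← h, ← pow_add,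
        ← add_assoc]
  refine ⟨(m + 1) * d, by positivity, ?_⟩
  rw [IsIdempotentElem, ← pow_add]
  exact per (m + 1) _ (by nlinarith)

/-- A finite ring without nontrivial idempotents is local with nilpotent radical. -/
lemma exists_isNilpotentLocalRadical {R : Type*} [Ring R] [Finite R] [Nontrivial R]
    (h : ∀ e : R, IsIdempotentElem e → e = 0 ∨ e = 1) :
    ∃ J : Submodule ℤ R, IsNilpotentLocalRadical J := by
  have dich (r : R) (hr : r ∉ Ring.jacobson R) : IsUnit r := by
    by_contra hu
    apply hr
    rw [← Ideal.jacobson_bot, Ideal.mem_jacobson_iff]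
    intro y
    have hyr : ¬ IsUnit (y * r) := fun ⟨v, hv⟩ => hu (IsUnit.of_mul_eq_one_right (↑v⁻¹ * y) (by
      rw [mul_assoc, ← hv, Units.inv_mul]))
    obtain ⟨n, hn, he⟩ := exists_pow_isIdempotentElem (y * r)
    have hnil : IsNilpotent (y * r) := by
      rcases h _ he with h0 | h1
      · exact ⟨n, h0⟩
      · exact absurd (IsUnit.of_pow_eq_one h1 hn) hyr
    obtain ⟨v, hv⟩ := hnil.isUnit_one_add
    refine ⟨↑v⁻¹, ?_⟩
    have h1 : (↑v⁻¹ : R) * y * r + ↑v⁻¹ - 1 = ↑v⁻¹ * (1 + y * r) - 1 := by noncomm_ring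
    rw [h1, ← hv, Units.inv_mul, sub_self]
    exact Submodule.zero_mem _
  refine ⟨(Ring.jacobson R).restrictScalars ℤ, fun r j hj => Ideal.mul_mem_left _ r hj,
    fun r j hj => Ideal.mul_mem_right r _ hj, dich,
    (Ideal.ne_top_iff_one _).1 (Ring.jacobson_lt_top R).ne, ?_⟩
  obtain ⟨n, hn⟩ := IsSemiprimaryRing.isNilpotent (R := R)
  refine ⟨n, eq_bot_iff.2 fun v hv => ?_⟩
  have key : ∀ k, ∀ v ∈ ((Ring.jacobson R).restrictScalars ℤ) ^ k, v ∈ Ring.jacobson R ^ k := by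
    intro k
    induction k with
    | zero => intro v _; simp [Submodule.pow_zero]
    | succ k ih =>
      intro v hv
      rw [pow_succ'] at hv
      rw [Ideal.IsTwoSided.pow_succ]
      refine Submodule.mul_induction_on hv (fun a ha b hb => ?_) (fun a b ha hb => ?_)
      · exact Ideal.mul_mem_mul ha (ih b hb)
      · exact Ideal.add_mem _ ha hb
  have h0 := key n v hv
  rw [hn] at h0
  simpa using h0

/-- In a finite group of prime power order, the exponents of the subgroup orders form a strictly
monotone function. -/
lemma exists_strictMono_length {R : Type*} [Ring R] [Finite R] {p : ℕ} (hp : p.Prime)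
    (h : Nat.card R ∣ p ^ 7) : ∃ ℓ : Submodule ℤ R → ℕ, StrictMono ℓ ∧ ℓ ⊤ ≤ 7 := by
  have key (M : Submodule ℤ R) : ∃ k ≤ 7, Nat.card M = p ^ k :=
    (Nat.dvd_prime_pow hp).1 ((M.toAddSubgroup.card_addSubgroup_dvd_card).trans h)
  choose ℓ hℓ7 hℓ using key
  refine ⟨ℓ, fun M N hMN => ?_, hℓ7 _⟩
  have h1 : Nat.card M < Nat.card N := Set.ncard_lt_ncard (s := (M : Set R)) (t := N) hMN
  rw [hℓ, hℓ] at h1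
  exact (Nat.pow_lt_pow_iff_right hp.one_lt).1 h1

section Corner

variable {R : Type*} [Ring R] {e : R}

lemma mem_corner_of_central (he : IsIdempotentElem e) (hc : e ∈ Subring.center R) (r : R) :
    e * r ∈ Subsemigroup.corner e :=
  (Subsemigroup.mem_corner_iff he).2 ⟨by rw [← mul_assoc, he.eq],
    by rw [mul_assoc, (Subring.mem_center_iff.1 hc r), ← mul_assoc, he.eq]⟩

lemma IsAbelianRing.corner (h : IsAbelianRing R) (he : IsIdempotentElem e) :
    IsAbelianRing he.Corner := by
  intro f hf
  have hf' : IsIdempotentElem f.1 := congrArg Subtype.val hf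
  exact Subring.mem_center_iff.2 fun g => Subtype.ext (Subring.mem_center_iff.1 (h _ hf') g.1)

lemma IsReflexiveRing.corner (h : IsReflexiveRing R) (he : IsIdempotentElem e) :
    IsReflexiveRing he.Corner := by
  intro a b hab r
  obtain ⟨ha1, ha2⟩ := (Subsemigroup.mem_corner_iff he).1 a.2
  obtain ⟨hb1, hb2⟩ := (Subsemigroup.mem_corner_iff he).1 b.2
  refine Subtype.ext (h a.1 b.1 (fun s => ?_) r.1)
  have h1 : a.1 * (e * s * e) * b.1 = 0 := congrArg Subtype.val (hab ⟨e * s * e, s, rfl⟩)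
  calc a.1 * s * b.1 = a.1 * e * s * (e * b.1) := by rw [ha2, hb1]
    _ = a.1 * (e * s * e) * b.1 := by noncomm_ring
    _ = 0 := h1

end Corner

/-- Finite abelian reflexive rings of order dividing `p ^ 7` are reversible: split off central
idempotents until the ring is local. -/
theorem isReversibleRing_of_card_dvd {R : Type*} [Ring R] [Finite R] {p : ℕ} (hp : p.Prime)
    (hcard : Nat.card R ∣ p ^ 7) (hab : IsAbelianRing R) (href : IsReflexiveRing R) :
    IsReversibleRing R := by
  induction hn : Nat.card R using Nat.strong_induction_on generalizing R with
  | _ n ih =>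
    subst hn
    rcases subsingleton_or_nontrivial R with hR | hR
    · exact fun a b _ => Subsingleton.elim _ _
    by_cases h : ∀ e : R, IsIdempotentElem e → e = 0 ∨ e = 1
    · obtain ⟨J, hJ⟩ := exists_isNilpotentLocalRadical h
      obtain ⟨ℓ, hℓ, hℓ7⟩ := exists_strictMono_length hp hcard
      exact hJ.isReversibleRing hℓ hℓ7 href
    push Not at h
    obtain ⟨e, he, he0, he1⟩ := h
    intro a b h
    -- Each corner at a nontrivial idempotent is a smaller ring.
    have key {f : R} (hf : IsIdempotentElem f) (hf1 : f ≠ 1) : f * (b * a) = 0 := by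
      have hfc := hab f hf
      have hcomm (r : R) : r * f = f * r := Subring.mem_center_iff.1 hfc r
      have : Finite hf.Corner := inferInstanceAs (Finite (Subsemigroup.corner f))
      let S : AddSubgroup R := (NonUnitalRing.corner f).toAddSubgroup
      have hlt : Nat.card hf.Corner < Nat.card R := by
        refine lt_of_le_of_ne (Nat.le_of_dvd Nat.card_pos (S.card_addSubgroup_dvd_card))
          fun heq => hf1 ?_
        have htop : S = ⊤ := AddSubgroup.eq_top_of_card_eq S heq
        have h1 : (1 : R) ∈ S := htop ▸ AddSubgroup.mem_top 1
        simpa using ((Subsemigroup.mem_corner_iff hf).1 h1).1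
      have hrev := ih _ hlt (R := hf.Corner) (S.card_addSubgroup_dvd_card.trans hcard)
        (hab.corner hf) (href.corner hf) rfl
      have hmul (r s : R) : f * r * (f * s) = f * (r * s) := by
        rw [mul_assoc, ← mul_assoc r, hcomm, ← mul_assoc, ← mul_assoc, hf.eq, mul_assoc]
      have h1 := congrArg Subtype.val (hrev ⟨f * a, mem_corner_of_central hf hfc a⟩
        ⟨f * b, mem_corner_of_central hf hfc b⟩ (Subtype.ext (by
          change f * a * (f * b) = 0
          rw [hmul, h, mul_zero])))
      change f * b * (f * a) = 0 at h1
      rwa [hmul] at h1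
    have h1 := key he he1
    have h2 := key he.one_sub (by simpa using he0)
    rwa [sub_mul, h1, one_mul, sub_zero] at h2

theorem mainTheorem1 {R : Type*} [Ring R] [Finite R] (p k : ℕ) (hp : p.Prime) (hk : k < 8)
    (hcard : Nat.card R = p ^ k) (habelian : IsAbelianRing R) (hreflexive : IsReflexiveRing R) :
    IsReversibleRing R ∧ IsSemicommutativeRing R := by
  have h := isReversibleRing_of_card_dvd hp
    (hcard ▸ pow_dvd_pow p (Nat.le_of_lt_succ hk)) habelian hreflexive
  refine ⟨h, fun a b hab r => h b (a * r) ?_⟩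
  rw [← mul_assoc, h a b hab, zero_mul]
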